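/- Let $(M,g)$ be a Riemannian symmetric space of dimension $n$: a smooth (Hausdorff, second countable) Riemannian $n$-manifold such that for every $p\in M$ there is an isometry $s_p$ of $M$ with $s_p(p)=p$ and $d(s_p)_p=-\mathrm{id}$. Let $\nabla$ be the Levi-Civita connection and $d\mathrm{vol}$ the Riemannian volume measure, and write $e_1,\dots,e_n$ for an orthonormal basis of a tangent space. Let $S$ be a symmetric covariant $2$-tensor on $M$. A local Killing field is a smooth vector field $\omega$ on an open set $U\subseteq M$ with $g(\nabla_v\omega,w)+g(v,\nabla_w\omega)=0$ for all $v,w\in T_xM$, $x\in U$; for such $\omega$, $(S,\omega)$ denotes the one-form $S(\omega,\cdot)$ on $U$. (a) Suppose that $S$ is locally integrable. Then $D^*S=0$ in the sense of distributions, that is, $$\int_M \sum_i S(e_i,\nabla_{e_i}X)\,d\mathrm{vol}=0\quad\text{for all smooth compactly supported vector fields }X,$$ if and only if for every local Killing field $\omega$ on an open set $U$ the one-form $(S,\omega)$ is co-closed on $U$ in the sense of distributions, $d^*(S,\omega)=0$ (equivalently, $*(S,\omega)$ is a closed $(n-1)$-form), that is, $$\int_U \sum_i S(\omega,e_i)\,d\varphi(e_i)\,d\mathrm{vol}=0\quad\text{for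 all smooth functions }\varphi\text{ with compact support in }U.$$ (b) Suppose that $S$ is of class $C^1$. Then $D^*S=-\sum_i(\nabla_{e_i}S)(e_i,\cdot)=0$ at every point of $M$ if and only if for every local Killing field $\omega$ on an open set $U$ one has $d^*(S,\omega)=-\sum_i(\nabla_{e_i}(S,\omega))(e_i)=0$ at every point of $U$. -/

import Mathlib

open scoped Manifold ContDiff Bundle

noncomputable section

namespace RiemannianTensor

open Bundle MeasureTheory

section Basic

/-- Vector fields on `M`, with no regularity imposed. -/
abbrev VField (n : ℕ) (M : Type*) [TopologicalSpace M]
    [ChartedSpace (EuclideanSpace ℝ (Fin n)) M] : Type _ :=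
  (x : M) → TangentSpace (𝓡 n) x

/-- One-forms on `M`, with no regularity imposed. -/
abbrev OneForm (n : ℕ) (M : Type*) [TopologicalSpace M]
    [ChartedSpace (EuclideanSpace ℝ (Fin n)) M] : Type _ :=
  (x : M) → TangentSpace (𝓡 n) x →L[ℝ] ℝ

/-- Covariant 2-tensors on `M`, with no regularity imposed. -/
abbrev TwoTensor (n : ℕ) (M : Type*) [TopologicalSpace M]
    [ChartedSpace (EuclideanSpace ℝ (Fin n)) M] : Type _ :=
  (x : M) → TangentSpace (𝓡 n) x →L[ℝ] TangentSpace (𝓡 n) x →L[ℝ] ℝ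

variable {n : ℕ} {M : Type*} [TopologicalSpace M] [ChartedSpace (EuclideanSpace ℝ (Fin n)) M]

/-- `S` is symmetric at every point. -/
def IsSymm (S : TwoTensor n M) : Prop :=
  ∀ (x : M) (v w : TangentSpace (𝓡 n) x), S x v w = S x w v

/-- The one-form `(S, X) = S(X, ·)`. -/
def contract (S : TwoTensor n M) (X : VField n M) : OneForm n M := fun x ↦ S x (X x)

variable [IsManifold (𝓡 n) ∞ M]

/-- The vector field `X` is smooth on the set `U`. -/
def SmoothOn (X : VField n M) (U : Set M) : Prop :=
  ContMDiffOn (𝓡 n) (𝓡 n).tangent ∞ (fun x ↦ (⟨x, X x⟩ : TangentBundle (𝓡 n) M)) U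

/-- `S` is of class `C¹`: its components `S(X, Y)` along smooth vector fields are `C¹`. -/
def IsC1 (S : TwoTensor n M) : Prop :=
  ∀ X Y : VField n M, SmoothOn X Set.univ → SmoothOn Y Set.univ →
    ContMDiff (𝓡 n) 𝓘(ℝ, ℝ) 1 (fun x ↦ S x (X x) (Y x))

/-- A vector field which extends the tangent vector `v` and is smooth near its base point. -/
def ext {x : M} (v : TangentSpace (𝓡 n) x) : VField n M :=
  FiberBundle.extend (EuclideanSpace ℝ (Fin n)) v

end Basic

section Riemannian

variable {n : ℕ} {M : Type*} [TopologicalSpace M] [ChartedSpace (EuclideanSpace ℝ (Fin n)) M]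
  [IsManifold (𝓡 n) ∞ M] [RiemannianBundle (fun x : M ↦ TangentSpace (𝓡 n) x)]

/-- The function `x ↦ g(X, Y)(x)`. -/
def metric (X Y : VField n M) : M → ℝ := fun x ↦ inner ℝ (X x) (Y x)

/-- An orthonormal basis of the tangent space at `x`. -/
def onb (x : M) : OrthonormalBasis (Fin (Module.finrank ℝ (TangentSpace (𝓡 n) x))) ℝ
    (TangentSpace (𝓡 n) x) :=
  haveI : FiniteDimensional ℝ (TangentSpace (𝓡 n) x) :=
    inferInstanceAs (FiniteDimensional ℝ (EuclideanSpace ℝ (Fin n)))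
  stdOrthonormalBasis ℝ (TangentSpace (𝓡 n) x)

/-- The right-hand side of the Koszul formula for `g(∇_X Y, Z)` at `x`. -/
def koszul (X Y Z : VField n M) (x : M) : ℝ :=
  (1 / 2) * (mvfderiv (𝓡 n) (metric Y Z) x (X x) + mvfderiv (𝓡 n) (metric X Z) x (Y x)
    - mvfderiv (𝓡 n) (metric X Y) x (Z x)
    + metric (VectorField.mlieBracket (𝓡 n) X Y) Z x
    - metric (VectorField.mlieBracket (𝓡 n) X Z) Y x
    - metric (VectorField.mlieBracket (𝓡 n) Y Z) X x)

/-- The Levi-Civita covariant derivative `∇_v Y`, for a tangent vector `v` at `x` and a vector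
field `Y` differentiable at `x`, obtained from the Koszul formula. -/
def leviCivita (Y : VField n M) {x : M} (v : TangentSpace (𝓡 n) x) : TangentSpace (𝓡 n) x :=
  ∑ i, koszul (ext v) Y (ext (onb x i)) x • onb x i

/-- `(∇_v α)(u)` for a one-form `α`. -/
def covOneForm (α : OneForm n M) {x : M} (v u : TangentSpace (𝓡 n) x) : ℝ :=
  mvfderiv (𝓡 n) (fun y ↦ α y (ext u y)) x v - α x (leviCivita (ext u) v)

/-- `(∇_v S)(u, w)` for a 2-tensor `S`. -/
def covTwoTensor (S : TwoTensor n M) {x : M} (v u w : TangentSpace (𝓡 n) x) : ℝ :=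
  mvfderiv (𝓡 n) (fun y ↦ S y (ext u y) (ext w y)) x v
    - S x (leviCivita (ext u) v) w - S x u (leviCivita (ext w) v)

/-- The codifferential `d*α = -∑ᵢ (∇_{eᵢ} α)(eᵢ)` of a one-form, at the point `x`. -/
def codiff (α : OneForm n M) (x : M) : ℝ :=
  - ∑ i, covOneForm α (onb x i) (onb x i)

/-- The value `(D*S)(w) = -∑ᵢ (∇_{eᵢ} S)(eᵢ, w)` of the divergence of a 2-tensor on a tangent
vector `w` at `x`. -/
def divAdjoint (S : TwoTensor n M) {x : M} (w : TangentSpace (𝓡 n) x) : ℝ :=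
  - ∑ i, covTwoTensor S (onb x i) (onb x i) w

/-- `X` restricts to a (smooth) Killing field on the open set `U`: `∇X` is skew on `U`. -/
structure IsKillingOn (X : VField n M) (U : Set M) : Prop where
  isOpen : IsOpen U
  smooth : SmoothOn X U
  skew : ∀ x ∈ U, ∀ v w : TangentSpace (𝓡 n) x,
    inner ℝ (leviCivita X v) w + inner ℝ v (leviCivita X w) = 0

variable (n M) in
/-- `M` is a Riemannian symmetric space: each point `p` is fixed by an isometry of `M` whose
differential at `p` is `-id`. (All tangent spaces are copies of `ℝⁿ` in the preferred chart, and
`s p = p`, so that the last equation makes sense in `ℝⁿ`.) -/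
def IsSymmetricSpace : Prop :=
  ∀ p : M, ∃ s : M ≃ₘ^∞⟮𝓡 n, 𝓡 n⟯ M,
    (∀ (x : M) (v w : TangentSpace (𝓡 n) x),
      inner ℝ (mfderiv (𝓡 n) (𝓡 n) s x v) (mfderiv (𝓡 n) (𝓡 n) s x w) = inner ℝ v w) ∧
    s p = p ∧
    ∀ v : EuclideanSpace ℝ (Fin n),
      (mfderiv (𝓡 n) (𝓡 n) s p v : EuclideanSpace ℝ (Fin n)) = -v

/-- The coordinate vector field `∂ᵢ` of the chart at `p`, at the point with coordinates `y`. -/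
def coordField (p : M) (y : EuclideanSpace ℝ (Fin n)) (i : Fin n) :
    TangentSpace (𝓡 n) ((chartAt (EuclideanSpace ℝ (Fin n)) p).symm y) :=
  mfderiv (𝓡 n) (𝓡 n) (chartAt (EuclideanSpace ℝ (Fin n)) p).symm y
    (EuclideanSpace.single i (1 : ℝ) : EuclideanSpace ℝ (Fin n))

/-- The Riemannian density `√(det gᵢⱼ)` in the chart at `p`. -/
def density (p : M) (y : EuclideanSpace ℝ (Fin n)) : ℝ :=
  Real.sqrt (Matrix.det (Matrix.of fun i j : Fin n ↦
    (inner ℝ (coordField p y i) (coordField p y j) : ℝ)))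

variable [MeasurableSpace M]

variable (n M) in
/-- The Riemannian volume measure: the smallest measure that dominates, on each chart domain, the
measure `√(det gᵢⱼ) dy¹…dyⁿ` (these agree on overlaps). -/
def riemannianVolume : Measure M :=
  ⨆ p : M, Measure.map (chartAt (EuclideanSpace ℝ (Fin n)) p).symm
    (((volume : Measure (EuclideanSpace ℝ (Fin n))).restrict
      (chartAt (EuclideanSpace ℝ (Fin n)) p).target).withDensity
        fun y ↦ ENNReal.ofReal (density p y))

/-- `S` is locally integrable (`L¹_loc`): its components `S(X, Y)` along smooth vector fields
are. -/
def IsL1Loc (S : TwoTensor n M) : Prop :=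
  ∀ X Y : VField n M, SmoothOn X Set.univ → SmoothOn Y Set.univ →
    LocallyIntegrable (fun x ↦ S x (X x) (Y x)) (riemannianVolume n M)

/-- `D*S = 0` in the sense of distributions: `∫ ⟨S, DX⟩ dvol = 0` for all smooth vector fields
`X` with compact support, where `⟨S, DX⟩ = ∑ᵢ S(eᵢ, ∇_{eᵢ} X)`. -/
def WeakDivFree (S : TwoTensor n M) : Prop :=
  ∀ X : VField n M, SmoothOn X Set.univ →
    (∃ K : Set M, IsCompact K ∧ ∀ x ∉ K, X x = 0) →
    ∫ x, ∑ i, S x (onb x i) (leviCivita X (onb x i)) ∂(riemannianVolume n M) = 0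

/-- `d*α = 0` on the open set `U` in the sense of distributions: `∫ ⟨α, dφ⟩ dvol = 0` for all
smooth functions `φ` with compact support in `U`; equivalently `∫ dφ ∧ *α = 0`, that is, the
`(n-1)`-form `*α` is closed on `U`. -/
def WeakCoclosedOn (α : OneForm n M) (U : Set M) : Prop :=
  ∀ φ : M → ℝ, ContMDiff (𝓡 n) 𝓘(ℝ, ℝ) ∞ φ → HasCompactSupport φ → tsupport φ ⊆ U →
    ∫ x, ∑ i, α x (onb x i) * mvfderiv (𝓡 n) φ x (onb x i) ∂(riemannianVolume n M) = 0

end Riemannian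

end RiemannianTensor

end

/-! The link between the two conditions is the contraction `∑ i, S(e_i, ∇_{e_i} K)`. It vanishes for
a Killing field `K`, because `S` is symmetric and `∇K` is skew (`sum_apply_skew_eq_zero`). By the
Leibniz rule the integrand for the field `φ K` is therefore `S(K, grad φ)`, which is exactly the
integrand that tests co-closedness of `(S, K)` against `φ` (`pairing_smul_of_isKillingOn`). So
testing `D*S = 0` on the fields `φ K` is the same as testing `d*(S, K) = 0`. At a point where `S` is
`C¹`, the same cancellation gives `d*(S, K) = (D*S)(K)` (`IsC1.codiff_contract`).

For the converses there must be enough Killing fields: every tangent vector is the value of a local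
one (`IsSymmetricSpace.exists_isKillingOn`). This settles the `C¹` case at once. In the weak case,
Killing fields with independent values at a point form a smooth frame nearby, so a partition of
unity writes every compactly supported field as a finite sum of fields `φ_i K_i`; local
integrability allows the integral to be split.

The Killing fields are built without the Lie group structure of the isometry group. In a chart, the
1-jet of an isometry solves a total differential equation `Dj = G(x, j)`, since its second
derivatives are determined by Christoffel symbols (`IsLocalIsometry.fderiv_fderiv`). With `q_k = p +
(t_k / 2) w`, the product of the symmetries at `p` and then at `q_k` moves `p` by `t_k w + O(t_k²)`
and has differential `1 + O(t_k)` there. Gronwall's inequality bounds the difference quotients of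
the jets against the identity, the equation makes them equi-Lipschitz, and Arzelà–Ascoli produces a
limit solving the linearised equation (`exists_linearised_solution`). Its base component is smooth,
has value `w` at `p`, and is Killing because each isometry preserves `g`
(`IsMetricOn.exists_killing`). A common domain for the symmetries exists because isometries do not
increase Riemannian distance. -/

noncomputable section

set_option maxSynthPendingDepth 3
set_option linter.unusedSectionVars false

namespace RiemannianTensor

open Bundle MeasureTheory

/-! ### Total differential equations and limits of difference quotients of solutions -/

section JetLimit

open Filter Topology Metric Set

variable {E V : Type*} [NormedAddCommGroup E] [NormedSpace ℝ E]
  [NormedAddCommGroup V] [NormedSpace ℝ V]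

/-- First order Taylor estimate, uniform on compact convex sets. -/
theorem exists_taylor_bound {f : E → V} {O K : Set E} (hO : IsOpen O) (hf : ContDiffOn ℝ ∞ f O)
    (hK : IsCompact K) (hc : Convex ℝ K) (hKO : K ⊆ O) :
    ∃ C : ℝ, 0 ≤ C ∧ ∀ x ∈ K, ∀ y ∈ K, ‖f y - f x - fderiv ℝ f x (y - x)‖ ≤ C * ‖y - x‖ ^ 2 := by
  have h1 : ContDiffOn ℝ 1 (fderiv ℝ f) K :=
    (hf.fderiv_of_isOpen (m := 1) hO (by norm_cast)).mono hKO
  obtain ⟨L, hL⟩ := h1.exists_lipschitzOnWith one_ne_zero hc hK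
  refine ⟨L, L.2, fun x hx y hy ↦ ?_⟩
  have hseg : segment ℝ x y ⊆ K := hc.segment_subset hx hy
  -- Mean value inequality for `f` minus its linearisation at `x`: on the segment the derivative
  -- stays within `L * ‖y - x‖` of `fderiv ℝ f x`.
  have := Convex.norm_image_sub_le_of_norm_hasFDerivWithin_le' (𝕜 := ℝ) (f := f)
    (C := L * ‖y - x‖) (s := segment ℝ x y) (f' := fderiv ℝ f) (φ := fderiv ℝ f x)
    (x := x) (y := y)
    (fun z hz ↦ ((hf.contDiffAt (hO.mem_nhds (hKO (hseg hz)))).differentiableAt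
      (by simp)).hasFDerivAt.hasFDerivWithinAt)
    (fun z hz ↦ by
      have := hL.dist_le_mul z (hseg hz) x hx
      rw [dist_eq_norm, dist_eq_norm] at this
      refine this.trans ?_
      gcongr
      exact norm_sub_le_of_mem_segment hz)
    (convex_segment x y) (left_mem_segment ℝ x y) (right_mem_segment ℝ x y)
  linarith [sq (‖y - x‖)]

/-- Two solutions of the total differential equation `Dj = G(x, j)` stay close. -/
theorem norm_sub_le_of_total_ode {G : E × V → E →L[ℝ] V} {K : Set (E × V)} {L : NNReal}
    (hG : LipschitzOnWith L G K) {p : E} {r : ℝ} {j j' : E → V}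
    (hj : ∀ x ∈ ball p r, (x, j x) ∈ K ∧ HasFDerivAt j (G (x, j x)) x)
    (hj' : ∀ x ∈ ball p r, (x, j' x) ∈ K ∧ HasFDerivAt j' (G (x, j' x)) x)
    {x : E} (hx : x ∈ ball p r) :
    ‖j x - j' x‖ ≤ ‖j p - j' p‖ * Real.exp (L * r) := by
  have hγ : ∀ s ∈ Icc (0 : ℝ) 1, p + s • (x - p) ∈ ball p r := by
    intro s hs
    rw [mem_ball, dist_eq_norm] at hx ⊢
    rw [add_sub_cancel_left, norm_smul, Real.norm_of_nonneg hs.1]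
    exact (mul_le_of_le_one_left (norm_nonneg _) hs.2).trans_lt hx
  have hd : ∀ s ∈ Icc (0 : ℝ) 1, HasDerivAt (fun s : ℝ ↦ j (p + s • (x - p)) - j' (p + s • (x - p)))
      ((G (p + s • (x - p), j (p + s • (x - p))) - G (p + s • (x - p), j' (p + s • (x - p))))
        (x - p)) s := by
    intro s hs
    have h0 : HasDerivAt (fun s : ℝ ↦ p + s • (x - p)) (x - p) s := by
      simpa using ((hasDerivAt_id s).smul_const (x - p)).const_add p
    exact ((hj _ (hγ s hs)).2.comp_hasDerivAt s h0).sub ((hj' _ (hγ s hs)).2.comp_hasDerivAt s h0)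
  have hxp : ‖x - p‖ ≤ r := by rw [← dist_eq_norm]; exact (mem_ball.1 hx).le
  -- Gronwall along the segment from `p` to `x`; the rate is `L * r` because the segment has length
  -- at most `r`.
  have := norm_le_gronwallBound_of_norm_deriv_right_le (a := 0) (b := 1)
    (δ := ‖j p - j' p‖) (K := L * r) (ε := 0)
    (fun s hs ↦ (hd s hs).continuousAt.continuousWithinAt)
    (fun s hs ↦ (hd s (Ico_subset_Icc_self hs)).hasDerivWithinAt)
    (by simp)
    (fun s hs ↦ by
      have hs := Ico_subset_Icc_self hs
      have h1 := hG.dist_le_mul _ (hj _ (hγ s hs)).1 _ (hj' _ (hγ s hs)).1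
      rw [dist_eq_norm, dist_eq_norm, Prod.mk_sub_mk, sub_self, Prod.norm_mk, norm_zero,
        max_eq_right (norm_nonneg _)] at h1
      calc _ ≤ _ := ContinuousLinearMap.le_opNorm _ _
        _ ≤ (L * ‖j (p + s • (x - p)) - j' (p + s • (x - p))‖) * r := by
          gcongr
        _ = _ := by ring)
    1 (right_mem_Icc.2 zero_le_one)
  simpa [gronwallBound_ε0] using this

/-- Smoothness of solutions of a total differential equation with smooth right-hand side. -/
theorem contDiffOn_of_total_ode {H : E × V → E →L[ℝ] V} {B : Set E} (hB : IsOpen B)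
    {O : Set (E × V)} (hH : ContDiffOn ℝ ∞ H O) {Z : E → V}
    (hZO : ∀ x ∈ B, (x, Z x) ∈ O) (hZ : ∀ x ∈ B, HasFDerivAt Z (H (x, Z x)) x) :
    ContDiffOn ℝ ∞ Z B := by
  rw [contDiffOn_infty]
  intro k
  induction k with
  | zero => exact contDiffOn_zero.2 fun x hx ↦ (hZ x hx).continuousAt.continuousWithinAt
  | succ k ih =>
    push_cast
    rw [contDiffOn_succ_iff_fderiv_of_isOpen hB]
    refine ⟨fun x hx ↦ (hZ x hx).differentiableAt.differentiableWithinAt, by simp, ?_⟩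
    -- Bootstrapping: if `Z` is `C^k`, the equation makes its derivative `C^k`.
    have : ContDiffOn ℝ k (fun x ↦ H (x, Z x)) B :=
      (hH.of_le (by exact_mod_cast le_top)).comp (contDiffOn_id.prodMk ih) hZO
    exact this.congr fun x hx ↦ (hZ x hx).fderiv

/-- Compactness: uniformly bounded, uniformly Lipschitz sequences on a ball converge along an
ultrafilter, uniformly on smaller balls. -/
theorem exists_limit_of_lipschitz [FiniteDimensional ℝ E] [FiniteDimensional ℝ V]
    {p : E} {r M : ℝ} {C : NNReal} {Z : ℕ → E → V} (hM : ∀ k, ∀ x ∈ ball p r, ‖Z k x‖ ≤ M)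
    (hC : ∀ k, LipschitzOnWith C (Z k) (ball p r)) :
    ∃ Y : E → V, (∀ x ∈ ball p r, Tendsto (fun k ↦ Z k x) (hyperfilter ℕ) (𝓝 (Y x))) ∧
      ∀ r' < r, TendstoUniformlyOn Z Y (hyperfilter ℕ) (closedBall p r') := by
  -- A single ultrafilter gives limits at all points simultaneously, so no diagonal subsequence is
  -- needed.
  have h1 : ∀ x, ∃ y, x ∈ ball p r → Tendsto (fun k ↦ Z k x) (hyperfilter ℕ) (𝓝 y) := by
    intro x
    by_cases hx : x ∈ ball p r
    · obtain ⟨y, -, hy⟩ := (isCompact_closedBall (0 : V) M).ultrafilter_le_nhds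
        ((hyperfilter ℕ).map (fun k ↦ Z k x)) (by
          rw [le_principal_iff]
          refine Filter.mem_map.2 (Filter.mem_of_superset univ_mem ?_)
          exact fun k _ ↦ mem_closedBall_zero_iff.2 (hM k x hx))
      exact ⟨y, fun _ ↦ hy⟩
    · exact ⟨0, fun h ↦ absurd h hx⟩
  choose Y hY using h1
  refine ⟨Y, hY, fun r' hr' ↦ ?_⟩
  have hsub : closedBall p r' ⊆ ball p r := closedBall_subset_ball hr'
  have := (EquicontinuousOn.tendsto_uniformOnFun_iff_pi' (𝔖 := {closedBall p r'}) (F := Z)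
    (by simpa using isCompact_closedBall p r')
    (by
      simp only [mem_singleton_iff, forall_eq]
      exact (LipschitzOnWith.uniformEquicontinuousOn Z C
        fun k ↦ (hC k).mono hsub).equicontinuousOn) (hyperfilter ℕ : Filter ℕ) Y).2 (by
    rw [tendsto_pi_nhds]
    rintro ⟨x, hx⟩
    exact hY x (hsub (by simpa using hx)))
  rw [UniformOnFun.tendsto_iff_tendstoUniformlyOn] at this
  exact this _ rfl

/-- Difference quotients of a sequence of solutions of `Dj = G(x, j)` which converges to a
solution `j₀` accumulate at a smooth solution of the linearised equation. -/
theorem exists_linearised_solution [FiniteDimensional ℝ E] [FiniteDimensional ℝ V]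
    {G : E × V → E →L[ℝ] V} {O K : Set (E × V)} (hO : IsOpen O) (hG : ContDiffOn ℝ ∞ G O)
    (hK : IsCompact K) (hc : Convex ℝ K) (hKO : K ⊆ O) {p : E} {r : ℝ}
    {j₀ : E → V} {j : ℕ → E → V}
    (hj₀ : ∀ x ∈ ball p r, (x, j₀ x) ∈ K ∧ HasFDerivAt j₀ (G (x, j₀ x)) x)
    (hj : ∀ k, ∀ x ∈ ball p r, (x, j k x) ∈ K ∧ HasFDerivAt (j k) (G (x, j k x)) x)
    {t : ℕ → ℝ} (ht : ∀ k, 0 < t k) (ht0 : Tendsto t atTop (𝓝 0)) {C : ℝ} 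
    (hC : ∀ k, ‖j k p - j₀ p‖ ≤ C * t k) :
    ∃ Z : E → V, ContDiffOn ℝ ∞ Z (ball p r) ∧
      ∀ x ∈ ball p r, HasFDerivAt Z (fderiv ℝ G (x, j₀ x) (0, Z x)) x ∧
        Tendsto (fun k ↦ (t k)⁻¹ • (j k x - j₀ x)) (hyperfilter ℕ) (𝓝 (Z x)) := by
  obtain ⟨L, hL⟩ := ((hG.mono hKO).of_le (m := 1) (by norm_cast)).exists_lipschitzOnWith
    one_ne_zero hc hK
  obtain ⟨C2, hC2, hT⟩ := exists_taylor_bound hO hG hK hc hKO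
  obtain ⟨C3, hC3⟩ := hK.exists_bound_of_continuousOn
    ((hG.continuousOn_fderiv_of_isOpen hO (by simp)).mono hKO)
  have hle : (hyperfilter ℕ : Filter ℕ) ≤ atTop := by
    rw [← Nat.cofinite_eq_atTop]; exact hyperfilter_le_cofinite
  set M := C * Real.exp (L * r) with hMdef
  set Z : ℕ → E → V := fun k x ↦ (t k)⁻¹ • (j k x - j₀ x) with hZdef
  have hdiff : ∀ k, ∀ x ∈ ball p r, ‖j k x - j₀ x‖ ≤ M * t k := fun k x hx ↦ by
    have := norm_sub_le_of_total_ode hL (hj k) hj₀ hx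
    calc _ ≤ _ := this
      _ ≤ C * t k * Real.exp (L * r) := by gcongr; exact hC k
      _ = _ := by rw [hMdef]; ring
  have hZM : ∀ k, ∀ x ∈ ball p r, ‖Z k x‖ ≤ M := fun k x hx ↦ by
    rw [hZdef]
    simp only
    rw [norm_smul, norm_inv, Real.norm_of_nonneg (ht k).le, inv_mul_le_iff₀ (ht k), mul_comm]
    exact hdiff k x hx
  have hZ' : ∀ k, ∀ x ∈ ball p r,
      HasFDerivAt (Z k) ((t k)⁻¹ • (G (x, j k x) - G (x, j₀ x))) x := fun k x hx ↦
    ((hj k x hx).2.sub (hj₀ x hx).2).const_smul _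
  have hsub : ∀ k x, ((x, j k x) : E × V) - (x, j₀ x) = t k • (0, Z k x) := fun k x ↦ by
    rw [Prod.mk_sub_mk, sub_self, Prod.smul_mk, smul_zero, smul_inv_smul₀ (ht k).ne']
  have hnorm : ∀ k x, ‖((x, j k x) : E × V) - (x, j₀ x)‖ = t k * ‖Z k x‖ := fun k x ↦ by
    rw [hsub, norm_smul, Real.norm_of_nonneg (ht k).le, Prod.norm_mk, norm_zero,
      max_eq_right (norm_nonneg _)]
  -- The equation bounds the derivative of the quotient by the Lipschitz constant of `G` times the
  -- bound `M` on the quotient itself.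
  have hLip : ∀ k, LipschitzOnWith (L * M.toNNReal) (Z k) (ball p r) := fun k ↦ by
    refine (convex_ball p r).lipschitzOnWith_of_nnnorm_hasFDerivWithin_le (𝕜 := ℝ)
      (fun x hx ↦ (hZ' k x hx).hasFDerivWithinAt) fun x hx ↦ ?_
    rw [← NNReal.coe_le_coe, coe_nnnorm, NNReal.coe_mul,
      Real.coe_toNNReal _ ((norm_nonneg _).trans (hZM k x hx)), norm_smul, norm_inv,
      Real.norm_of_nonneg (ht k).le, inv_mul_le_iff₀ (ht k)]
    have := hL.dist_le_mul _ (hj k x hx).1 _ (hj₀ x hx).1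
    rw [dist_eq_norm, dist_eq_norm, hnorm] at this
    calc _ ≤ _ := this
      _ ≤ L * (t k * M) := by gcongr; exacts [(ht k).le, hZM k x hx]
      _ = _ := by ring
  obtain ⟨Y, hY, hYu⟩ := exists_limit_of_lipschitz hZM hLip
  have hYd : ∀ x ∈ ball p r, HasFDerivAt Y (fderiv ℝ G (x, j₀ x) (0, Y x)) x := by
    intro x hx
    obtain ⟨r', hr', hr⟩ := exists_between (mem_ball.1 hx)
    have hss : ball p r' ⊆ ball p r := ball_subset_ball hr.le
    refine hasFDerivAt_of_tendstoUniformlyOn (l := (hyperfilter ℕ : Filter ℕ)) (f := Z)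
      (f' := fun k x ↦ (t k)⁻¹ • (G (x, j k x) - G (x, j₀ x)))
      (g' := fun x ↦ fderiv ℝ G (x, j₀ x) (0, Y x)) isOpen_ball ?_
      (fun k y hy ↦ hZ' k y (hss hy)) (fun y hy ↦ hY y (hss hy)) (mem_ball.2 hr')
    -- The derivatives converge uniformly: replacing the increment of `G` by its linear part costs
    -- `O(t k)`, and the linear part applied to `Z k - Y` is small by uniform convergence.
    rw [Metric.tendstoUniformlyOn_iff]
    intro ε hε
    have e1 : ∀ᶠ k in (hyperfilter ℕ : Filter ℕ), C2 * M ^ 2 * t k < ε / 2 := by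
      have : Tendsto (fun k ↦ C2 * M ^ 2 * t k) (hyperfilter ℕ) (𝓝 (C2 * M ^ 2 * 0)) :=
        (ht0.mono_left hle).const_mul _
      rw [mul_zero] at this
      exact this.eventually (gt_mem_nhds (half_pos hε))
    have e2 := (Metric.tendstoUniformlyOn_iff.1 (hYu r' hr)) (ε / 2 / (|C3| + 1)) (by positivity)
    filter_upwards [e1, e2] with k h1 h2 y hy
    have hyr := hss hy
    have h2 := h2 y (ball_subset_closedBall hy)
    have key := hT _ (hj₀ y hyr).1 _ (hj k y hyr).1
    rw [hnorm, hsub, map_smul] at key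
    rw [dist_comm, dist_eq_norm]
    rw [dist_comm, dist_eq_norm] at h2
    have s1 : ‖(t k)⁻¹ • (G (y, j k y) - G (y, j₀ y)) - fderiv ℝ G (y, j₀ y) (0, Z k y)‖
        ≤ C2 * M ^ 2 * t k := by
      have : (t k)⁻¹ • (G (y, j k y) - G (y, j₀ y)) - fderiv ℝ G (y, j₀ y) (0, Z k y)
          = (t k)⁻¹ • (G (y, j k y) - G (y, j₀ y) - t k • fderiv ℝ G (y, j₀ y) (0, Z k y)) := by
        rw [smul_sub (t k)⁻¹ (G (y, j k y) - G (y, j₀ y)), inv_smul_smul₀ (ht k).ne']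
      rw [this, norm_smul, norm_inv, Real.norm_of_nonneg (ht k).le, inv_mul_le_iff₀ (ht k)]
      calc _ ≤ _ := key
        _ ≤ C2 * (t k * M) ^ 2 := by
          have := hZM k y hyr
          have := (ht k).le
          gcongr
        _ = _ := by ring
    have s2 : ‖fderiv ℝ G (y, j₀ y) (0, Z k y) - fderiv ℝ G (y, j₀ y) (0, Y y)‖
        ≤ ε / 2 := by
      rw [← map_sub, Prod.mk_sub_mk, sub_self]
      calc _ ≤ ‖fderiv ℝ G (y, j₀ y)‖ * ‖((0 : E), Z k y - Y y)‖ :=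
            ContinuousLinearMap.le_opNorm _ _
        _ ≤ (|C3| + 1) * (ε / 2 / (|C3| + 1)) := by
          gcongr
          · exact ((hC3 _ (hj₀ y hyr).1).trans (le_abs_self _)).trans (by linarith)
          · rw [Prod.norm_mk, norm_zero, max_eq_right (norm_nonneg _)]
            exact h2.le
        _ = ε / 2 := by field_simp
    calc _ ≤ _ := norm_sub_le_norm_sub_add_norm_sub _ (fderiv ℝ G (y, j₀ y) (0, Z k y)) _
      _ < ε := by linarith
  have hj₀s : ContDiffOn ℝ ∞ j₀ (ball p r) :=
    contDiffOn_of_total_ode isOpen_ball hG (fun x hx ↦ hKO (hj₀ x hx).1) fun x hx ↦ (hj₀ x hx).2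
  refine ⟨Y, ?_, fun x hx ↦ ⟨hYd x hx, hY x hx⟩⟩
  have hG' : ContDiffOn ℝ ∞ (fderiv ℝ G) O := hG.fderiv_of_isOpen hO (by simp)
  -- The linearised equation is again a total differential equation, with smooth right-hand side
  -- because `j₀` is smooth.
  refine contDiffOn_of_total_ode (H := fun z : E × V ↦ fderiv ℝ G (z.1, j₀ z.1) (0, z.2))
    (O := ball p r ×ˢ univ) isOpen_ball ?_ (fun x hx ↦ ⟨hx, mem_univ _⟩) hYd
  refine ContDiffOn.clm_apply (hG'.comp (g := fderiv ℝ G) (f := fun z : E × V ↦ (z.1, j₀ z.1))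
    (contDiffOn_fst.prodMk (hj₀s.comp contDiffOn_fst fun z hz ↦ hz.1))
    fun z hz ↦ hKO (hj₀ z.1 hz.1).1) (contDiffOn_const.prodMk contDiffOn_snd)

end JetLimit

/-! ### Metrics in coordinates and the jet equation of local isometries -/

section CoordinateMetric

open Filter Topology Metric Set ContinuousLinearMap

variable {E : Type*} [NormedAddCommGroup E] [NormedSpace ℝ E]

/-- `g` is a smooth Riemannian metric on the open subset `Ω` of a vector space. -/
structure IsMetricOn (g : E → E →L[ℝ] E →L[ℝ] ℝ) (Ω : Set E) : Prop where
  isOpen : IsOpen Ω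
  smooth : ContDiffOn ℝ ∞ g Ω
  symm : ∀ x ∈ Ω, ∀ v w, g x v w = g x w v
  pos : ∀ x ∈ Ω, ∀ v, v ≠ 0 → 0 < g x v v

/-- The Christoffel symbols of the first kind. -/
def christoffelLower (g : E → E →L[ℝ] E →L[ℝ] ℝ) (x : E) : E →L[ℝ] E →L[ℝ] E →L[ℝ] ℝ :=
  (1 / 2 : ℝ) • (fderiv ℝ g x + (fderiv ℝ g x).flip
    - (flipₗᵢ ℝ E E ℝ : (E →L[ℝ] E →L[ℝ] ℝ) →L[ℝ] E →L[ℝ] E →L[ℝ] ℝ) ∘L (fderiv ℝ g x).flip)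

theorem christoffelLower_apply (g : E → E →L[ℝ] E →L[ℝ] ℝ) (x u v w : E) :
    christoffelLower g x u v w = (1 / 2) * (fderiv ℝ g x u v w + fderiv ℝ g x v u w
      - fderiv ℝ g x w u v) := rfl

/-- The Christoffel symbols of the second kind. -/
def christoffel (g : E → E →L[ℝ] E →L[ℝ] ℝ) (x : E) : E →L[ℝ] E →L[ℝ] E :=
  compL ℝ E (E →L[ℝ] ℝ) E (inverse (g x)) ∘L christoffelLower g x

/-- The second derivatives of an isometry, as a function of its source, value and derivative. -/
def isometryHessian (g : E → E →L[ℝ] E →L[ℝ] ℝ) (z : E × E × (E →L[ℝ] E)) :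
    E →L[ℝ] E →L[ℝ] E :=
  compL ℝ E E E z.2.2 ∘L christoffel g z.1 - (christoffel g z.2.1).bilinearComp z.2.2 z.2.2

theorem isometryHessian_apply (g : E → E →L[ℝ] E →L[ℝ] ℝ) (z : E × E × (E →L[ℝ] E)) (u v : E) :
    isometryHessian g z u v
      = z.2.2 (christoffel g z.1 u v) - christoffel g z.2.1 (z.2.2 u) (z.2.2 v) := rfl

/-- The total differential equation satisfied by the 1-jet of an isometry. -/
def isometryJetRHS (g : E → E →L[ℝ] E →L[ℝ] ℝ) (z : E × E × (E →L[ℝ] E)) :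
    E →L[ℝ] E × (E →L[ℝ] E) :=
  z.2.2.prod (isometryHessian g z)

/-- `f` is a smooth local isometry for `g`, defined on the open set `B` and with values in `K`. -/
structure IsLocalIsometry (g : E → E →L[ℝ] E →L[ℝ] ℝ) (f : E → E) (B K : Set E) : Prop where
  isOpen : IsOpen B
  smooth : ContDiffOn ℝ ∞ f B
  mapsTo : MapsTo f B K
  isom : ∀ x ∈ B, ∀ v w, g (f x) (fderiv ℝ f x v) (fderiv ℝ f x w) = g x v w

variable {g : E → E →L[ℝ] E →L[ℝ] ℝ} {Ω : Set E}

/-- The isometry equation on fixed vectors `v`, `w`, differentiated at `x` in the direction `u`. -/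
theorem IsLocalIsometry.hasFDerivAt_metric (hg : IsMetricOn g Ω) {f : E → E} {B K : Set E}
    (hf : IsLocalIsometry g f B K) (hB : B ⊆ Ω) (hK : K ⊆ Ω) {x : E} (hx : x ∈ B) (u v w : E) :
    fderiv ℝ g (f x) (fderiv ℝ f x u) (fderiv ℝ f x v) (fderiv ℝ f x w)
      + g (f x) (fderiv ℝ (fderiv ℝ f) x u v) (fderiv ℝ f x w)
      + g (f x) (fderiv ℝ f x v) (fderiv ℝ (fderiv ℝ f) x u w) = fderiv ℝ g x u v w := by
  have hBx := hf.isOpen.mem_nhds hx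
  have hfx : DifferentiableAt ℝ f x := (hf.smooth.contDiffAt hBx).differentiableAt (by simp)
  have hf'x : DifferentiableAt ℝ (fderiv ℝ f) x :=
    ((hf.smooth.fderiv_of_isOpen hf.isOpen (m := ∞) (by simp)).contDiffAt hBx).differentiableAt
      (by simp)
  have hgx : ∀ y ∈ Ω, DifferentiableAt ℝ g y := fun y hy ↦
    (hg.smooth.contDiffAt (hg.isOpen.mem_nhds hy)).differentiableAt (by simp)
  have hgf := (hgx _ (hK (hf.mapsTo hx))).hasFDerivAt.comp x hfx.hasFDerivAt
  have hl := (hgf.clm_apply (hf'x.hasFDerivAt.clm_apply (hasFDerivAt_const v x))).clm_apply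
    (hf'x.hasFDerivAt.clm_apply (hasFDerivAt_const w x))
  have hr := ((hgx _ (hB hx)).hasFDerivAt.clm_apply (hasFDerivAt_const v x)).clm_apply
    (hasFDerivAt_const w x)
  have := DFunLike.congr_fun (hl.unique (hr.congr_of_eventuallyEq
    (Filter.eventually_of_mem hBx fun y hy ↦ hf.isom y hy v w))) u
  simp at this
  linarith

variable [FiniteDimensional ℝ E]

theorem IsMetricOn.isInvertible (hg : IsMetricOn g Ω) {x : E} (hx : x ∈ Ω) :
    (g x).IsInvertible := by
  have hinj : Function.Injective (g x : E →ₗ[ℝ] E →L[ℝ] ℝ) := by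
    rw [← LinearMap.ker_eq_bot, LinearMap.ker_eq_bot']
    intro v hv
    by_contra h
    have := hg.pos x hx v h
    have h2 : g x v = 0 := hv
    rw [h2] at this
    simp at this
  have hdim : Module.finrank ℝ E = Module.finrank ℝ (E →L[ℝ] ℝ) := by
    rw [← (LinearMap.toContinuousLinearMap (𝕜 := ℝ) (E := E) (F' := ℝ)).finrank_eq]
    exact (Subspace.dual_finrank_eq).symm
  exact ⟨(LinearEquiv.ofInjectiveOfFinrankEq _ hinj hdim).toContinuousLinearEquiv, rfl⟩

theorem IsMetricOn.inverse_apply (hg : IsMetricOn g Ω) {x : E} (hx : x ∈ Ω) (l : E →L[ℝ] ℝ) :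
    g x (inverse (g x) l) = l := by
  obtain ⟨e, he⟩ := hg.isInvertible hx
  rw [← he]
  simp

theorem IsMetricOn.apply_christoffel (hg : IsMetricOn g Ω) {x : E} (hx : x ∈ Ω) (u v w : E) :
    g x (christoffel g x u v) w = christoffelLower g x u v w := by
  have := hg.inverse_apply hx (christoffelLower g x u v)
  exact DFunLike.congr_fun this w

theorem IsMetricOn.contDiffOn_christoffel (hg : IsMetricOn g Ω) :
    ContDiffOn ℝ ∞ (christoffel g) Ω := by
  have hd : ContDiffOn ℝ ∞ (fderiv ℝ g) Ω := hg.smooth.fderiv_of_isOpen hg.isOpen (by simp)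
  have hl : ContDiffOn ℝ ∞ (christoffelLower g) Ω := by
    simp only [contDiffOn_clm_apply] at hd ⊢
    intro u v w
    simp only [christoffelLower_apply]
    exact contDiffOn_const.mul (((hd u v w).add (hd v u w)).sub (hd w u v))
  have hi : ContDiffOn ℝ ∞ (fun x ↦ inverse (g x)) Ω := fun x hx ↦
    ((hg.isInvertible hx).contDiffAt_map_inverse).comp_contDiffWithinAt x (hg.smooth x hx)
  simp only [contDiffOn_clm_apply] at hl ⊢
  intro u v
  exact hi.clm_apply (contDiffOn_clm_apply.2 (hl u v))

theorem IsMetricOn.contDiffOn_isometryJetRHS (hg : IsMetricOn g Ω) :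
    ContDiffOn ℝ ∞ (isometryJetRHS g) (Ω ×ˢ Ω ×ˢ univ) := by
  have hΓ := hg.contDiffOn_christoffel
  have h1 : ContDiffOn ℝ ∞ (fun z : E × E × (E →L[ℝ] E) ↦ christoffel g z.1)
      (Ω ×ˢ Ω ×ˢ univ) := hΓ.comp contDiffOn_fst fun z hz ↦ hz.1
  have h2 : ContDiffOn ℝ ∞ (fun z : E × E × (E →L[ℝ] E) ↦ christoffel g z.2.1)
      (Ω ×ˢ Ω ×ˢ univ) := hΓ.comp (contDiff_fst.comp contDiff_snd).contDiffOn fun z hz ↦ hz.2.1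
  have h3 : ContDiffOn ℝ ∞ (fun z : E × E × (E →L[ℝ] E) ↦ z.2.2) (Ω ×ˢ Ω ×ˢ univ) :=
    (contDiff_snd.comp contDiff_snd).contDiffOn
  rw [contDiffOn_clm_apply]
  intro u
  refine (h3.clm_apply contDiffOn_const).prodMk ?_
  rw [contDiffOn_clm_apply]
  intro v
  change ContDiffOn ℝ ∞ (fun z : E × E × (E →L[ℝ] E) ↦
    z.2.2 (christoffel g z.1 u v) - christoffel g z.2.1 (z.2.2 u) (z.2.2 v)) _
  exact (h3.clm_apply ((h1.clm_apply contDiffOn_const).clm_apply contDiffOn_const)).sub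
    ((h2.clm_apply (h3.clm_apply contDiffOn_const)).clm_apply (h3.clm_apply contDiffOn_const))

theorem IsLocalIsometry.surjective (hg : IsMetricOn g Ω) {f : E → E} {B K : Set E}
    (hf : IsLocalIsometry g f B K) (hB : B ⊆ Ω) {x : E} (hx : x ∈ B) :
    Function.Surjective (fderiv ℝ f x) := by
  have hinj : Function.Injective (fderiv ℝ f x : E →ₗ[ℝ] E) := by
    rw [← LinearMap.ker_eq_bot, LinearMap.ker_eq_bot']
    intro v hv
    by_contra h
    have h1 := hg.pos x (hB hx) v h
    have h2 : fderiv ℝ f x v = 0 := hv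
    rw [← hf.isom x hx, h2] at h1
    simp at h1
  exact LinearMap.surjective_of_injective hinj

/-- Koszul's trick: the differentiated isometry equation, taken with three permutations of its
arguments, isolates the second derivative thanks to its symmetry. Hence the 1-jet determines all
higher derivatives. -/
theorem IsLocalIsometry.fderiv_fderiv (hg : IsMetricOn g Ω) {f : E → E} {B K : Set E}
    (hf : IsLocalIsometry g f B K) (hB : B ⊆ Ω) (hK : K ⊆ Ω) {x : E} (hx : x ∈ B) :
    fderiv ℝ (fderiv ℝ f) x = isometryHessian g (x, f x, fderiv ℝ f x) := by
  have hsymm : ∀ u v, fderiv ℝ (fderiv ℝ f) x u v = fderiv ℝ (fderiv ℝ f) x v u := fun u v ↦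
    ((hf.smooth.contDiffAt (hf.isOpen.mem_nhds hx)).isSymmSndFDerivAt (by
      rw [minSmoothness_of_isRCLikeNormedField]; exact WithTop.coe_le_coe.2 le_top)).eq u v
  have hfx := hK (hf.mapsTo hx)
  have gs := hg.symm _ hfx
  ext u v
  -- The difference of the two sides is itself in the image of the differential, so its square norm
  -- is one of the inner products that the Koszul combination evaluates to zero.
  obtain ⟨w, hw⟩ := hf.surjective hg hB hx
    (fderiv ℝ (fderiv ℝ f) x u v - isometryHessian g (x, f x, fderiv ℝ f x) u v)
  rw [← sub_eq_zero]
  by_contra hne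
  refine (hg.pos _ hfx _ hne).ne' ?_
  nth_rewrite 2 [← hw]
  have e1 := hf.hasFDerivAt_metric hg hB hK hx u v w
  have e2 := hf.hasFDerivAt_metric hg hB hK hx v u w
  have e3 := hf.hasFDerivAt_metric hg hB hK hx w u v
  rw [isometryHessian_apply, map_sub, map_sub, sub_apply, sub_apply, hf.isom x hx,
    hg.apply_christoffel (hB hx), hg.apply_christoffel hfx, christoffelLower_apply,
    christoffelLower_apply]
  rw [hsymm v u] at e2
  rw [hsymm w u, hsymm w v] at e3
  rw [gs (fderiv ℝ f x v)] at e1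
  rw [gs (fderiv ℝ f x u) (fderiv ℝ (fderiv ℝ f) x v w)] at e2 e3
  simp only
  linarith [gs (fderiv ℝ f x v) (fderiv ℝ (fderiv ℝ f) x u w)]

theorem IsLocalIsometry.hasFDerivAt_jet (hg : IsMetricOn g Ω) {f : E → E} {B K : Set E}
    (hf : IsLocalIsometry g f B K) (hB : B ⊆ Ω) (hK : K ⊆ Ω) {x : E} (hx : x ∈ B) :
    HasFDerivAt (fun y ↦ (f y, fderiv ℝ f y)) (isometryJetRHS g (x, f x, fderiv ℝ f x)) x := by
  have hBx := hf.isOpen.mem_nhds hx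
  have hfx : DifferentiableAt ℝ f x := (hf.smooth.contDiffAt hBx).differentiableAt (by simp)
  have hf'x : DifferentiableAt ℝ (fderiv ℝ f) x :=
    ((hf.smooth.fderiv_of_isOpen hf.isOpen (m := ∞) (by simp)).contDiffAt hBx).differentiableAt
      (by simp)
  have := hfx.hasFDerivAt.prodMk hf'x.hasFDerivAt
  rwa [hf.fderiv_fderiv hg hB hK hx] at this

/-- Derivatives of local isometries between compact sets are uniformly bounded. -/
theorem IsMetricOn.exists_bound_fderiv (hg : IsMetricOn g Ω) {K : Set E} (hK : IsCompact K)
    (hKΩ : K ⊆ Ω) : ∃ C : ℝ, 0 ≤ C ∧ ∀ (f : E → E) (B : Set E), IsLocalIsometry g f B K → B ⊆ K →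
      ∀ x ∈ B, ‖fderiv ℝ f x‖ ≤ C := by
  obtain ⟨C1, hC1⟩ := hK.exists_bound_of_continuousOn (hg.smooth.continuousOn.mono hKΩ)
  obtain ⟨c, hc, hc2⟩ : ∃ c : ℝ, 0 < c ∧ ∀ x ∈ K, ∀ v, c * ‖v‖ ^ 2 ≤ g x v v := by
    have hcont : ContinuousOn (fun z : E × E ↦ g z.1 z.2 z.2) (K ×ˢ sphere (0 : E) 1) := by
      have : ContinuousOn (fun z : E × E ↦ g z.1) (K ×ˢ sphere (0 : E) 1) :=
        (hg.smooth.continuousOn.mono hKΩ).comp continuousOn_fst fun z hz ↦ hz.1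
      exact (this.clm_apply continuousOn_snd).clm_apply continuousOn_snd
    obtain ⟨c, hc, hcb⟩ : ∃ c : ℝ, 0 < c ∧ ∀ z ∈ K ×ˢ sphere (0 : E) 1, c ≤ g z.1 z.2 z.2 := by
      rcases (K ×ˢ sphere (0 : E) 1).eq_empty_or_nonempty with h | h
      · exact ⟨1, one_pos, fun z hz ↦ by simp [h] at hz⟩
      · obtain ⟨z, hz, hmin⟩ := (hK.prod (isCompact_sphere 0 1)).exists_isMinOn h hcont
        refine ⟨_, hg.pos _ (hKΩ hz.1) z.2 ?_, fun y hy ↦ hmin hy⟩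
        rintro h0
        have := hz.2
        simp [h0] at this
    refine ⟨c, hc, fun x hx v ↦ ?_⟩
    by_cases hv : v = 0
    · simp [hv]
    · have hv' : ‖v‖ ≠ 0 := norm_ne_zero_iff.2 hv
      have := hcb (x, ‖v‖⁻¹ • v) ⟨hx, by simp [norm_smul, hv']⟩
      simp only [map_smul, smul_apply, smul_eq_mul] at this
      calc c * ‖v‖ ^ 2 ≤ (‖v‖⁻¹ * (‖v‖⁻¹ * g x v v)) * ‖v‖ ^ 2 := by gcongr
        _ = _ := by field_simp
  -- The constant comes from `c ‖df v‖² ≤ g(df v, df v) = g(v, v) ≤ |C1| ‖v‖²`.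
  refine ⟨Real.sqrt (|C1| / c), Real.sqrt_nonneg _, fun f B hf hB x hx ↦ ?_⟩
  refine opNorm_le_bound _ (Real.sqrt_nonneg _) fun v ↦ ?_
  have h1 := hc2 _ (hf.mapsTo hx) (fderiv ℝ f x v)
  rw [hf.isom x hx] at h1
  have h2 : g x v v ≤ |C1| * ‖v‖ ^ 2 := by
    calc g x v v ≤ ‖g x v v‖ := le_abs_self _
      _ ≤ ‖g x‖ * ‖v‖ * ‖v‖ := le_opNorm₂ _ _ _
      _ ≤ |C1| * ‖v‖ * ‖v‖ := by
        gcongr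
        exact (hC1 x (hB hx)).trans (le_abs_self _)
      _ = _ := by ring
  rw [← Real.sqrt_sq (norm_nonneg v), ← Real.sqrt_mul (by positivity)]
  apply Real.le_sqrt_of_sq_le
  rw [div_mul_eq_mul_div, le_div_iff₀ hc]
  linarith

end CoordinateMetric

/-! ### Killing fields as limits of products of two geodesic symmetries -/

section CoordinateKilling

open Filter Topology Metric Set ContinuousLinearMap

variable {E : Type*} [NormedAddCommGroup E] [NormedSpace ℝ E]
  {g : E → E →L[ℝ] E →L[ℝ] ℝ} {Ω : Set E}

theorem IsLocalIsometry.comp {f h : E → E} {B B' K : Set E} {K' : Set E}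
    (hf : IsLocalIsometry g f B K) (hh : IsLocalIsometry g h B' K') (hm : MapsTo h B' B) :
    IsLocalIsometry g (f ∘ h) B' K where
  isOpen := hh.isOpen
  smooth := hf.smooth.comp hh.smooth hm
  mapsTo := hf.mapsTo.comp hm
  isom x hx v w := by
    have h1 : DifferentiableAt ℝ h x :=
      (hh.smooth.contDiffAt (hh.isOpen.mem_nhds hx)).differentiableAt (by simp)
    have h2 : DifferentiableAt ℝ f (h x) :=
      (hf.smooth.contDiffAt (hf.isOpen.mem_nhds (hm hx))).differentiableAt (by simp)
    rw [fderiv_comp x h2 h1]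
    exact (hf.isom _ (hm hx) _ _).trans (hh.isom x hx v w)

theorem IsLocalIsometry.mono {f : E → E} {B B' K : Set E}
    (hf : IsLocalIsometry g f B K) (hB : B' ⊆ B) (ho : IsOpen B') : IsLocalIsometry g f B' K :=
  ⟨ho, hf.smooth.mono hB, hf.mapsTo.mono_left hB, fun x hx ↦ hf.isom x (hB hx)⟩

theorem isLocalIsometry_id {B K : Set E} (hB : IsOpen B) (hBK : B ⊆ K) :
    IsLocalIsometry g id B K :=
  ⟨hB, contDiffOn_id, hBK, fun x _ v w ↦ by simp⟩

/-- The base component of the jet equation is already linear in the jet. For a linearised solution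
it therefore says that the second component is the derivative of the first. -/
theorem fderiv_isometryJetRHS_fst {z : E × E × (E →L[ℝ] E)}
    (hG : DifferentiableAt ℝ (isometryJetRHS g) z) (d : E × E × (E →L[ℝ] E)) (v : E) :
    (fderiv ℝ (isometryJetRHS g) z d v).1 = d.2.2 v := by
  have h1 := (hG.hasFDerivAt.clm_apply (hasFDerivAt_const v z)).fst
  have h2 : HasFDerivAt (fun z : E × E × (E →L[ℝ] E) ↦ z.2.2 v) _ z :=
    (hasFDerivAt_id z).snd.snd.clm_apply (hasFDerivAt_const v z)
  have := DFunLike.congr_fun (h1.unique h2) d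
  simpa using this

/-- First and second order behaviour of a local geodesic symmetry about a nearby point. -/
theorem norm_symmetry_sub_le {f : E → E} {B : Set E} (hB : Convex ℝ B) {C : ℝ}
    {f'' : E → E →L[ℝ] E →L[ℝ] E} (hf : ∀ x ∈ B, DifferentiableAt ℝ f x)
    (hf' : ∀ x ∈ B, HasFDerivAt (fderiv ℝ f) (f'' x) x)
    (hC : ∀ x ∈ B, ‖f'' x‖ ≤ C) {p q : E} (hp : p ∈ B) (hq : q ∈ B) (hfq : f q = q)
    (hdq : fderiv ℝ f q = -ContinuousLinearMap.id ℝ E) :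
    ‖fderiv ℝ f p + ContinuousLinearMap.id ℝ E‖ ≤ C * ‖p - q‖ ∧
      ‖f p - q + (p - q)‖ ≤ C * ‖p - q‖ ^ 2 := by
  have hC0 : 0 ≤ C := (norm_nonneg _).trans (hC p hp)
  have h1 : ∀ x ∈ B, ‖fderiv ℝ f x + ContinuousLinearMap.id ℝ E‖ ≤ C * ‖x - q‖ := fun x hx ↦ by
    have := hB.norm_image_sub_le_of_norm_hasFDerivWithin_le (𝕜 := ℝ)
      (fun x hx ↦ (hf' x hx).hasFDerivWithinAt) hC hq hx
    rwa [hdq, sub_neg_eq_add] at this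
  refine ⟨h1 p hp, ?_⟩
  have hseg := hB.segment_subset hq hp
  have := (convex_segment q p).norm_image_sub_le_of_norm_hasFDerivWithin_le' (𝕜 := ℝ)
    (f := f) (f' := fderiv ℝ f) (φ := -ContinuousLinearMap.id ℝ E) (C := C * ‖p - q‖)
    (fun x hx ↦ (hf x (hseg hx)).hasFDerivAt.hasFDerivWithinAt)
    (fun x hx ↦ by
      rw [sub_neg_eq_add]
      refine (h1 x (hseg hx)).trans ?_
      gcongr
      exact norm_sub_le_of_mem_segment hx)
    (left_mem_segment ℝ q p) (right_mem_segment ℝ q p)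
  rw [hfq, neg_apply, ContinuousLinearMap.id_apply, sub_neg_eq_add] at this
  rwa [sq, ← mul_assoc]

/-- In a Riemannian metric on an open set with geodesic symmetries about all points close to `p`,
defined on a fixed neighbourhood of `p`, every vector at `p` is the value of a Killing field. -/
theorem IsMetricOn.exists_killing [FiniteDimensional ℝ E] (hg : IsMetricOn g Ω) {p : E} {r R : ℝ}
    (hr : 0 < r) (hrR : r ≤ R) (hR : closedBall p R ⊆ Ω) {σ : E → E → E}
    (hσ : ∀ q ∈ ball p r, IsLocalIsometry g (σ q) (ball p r) (closedBall p R) ∧ σ q q = q ∧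
      fderiv ℝ (σ q) q = -ContinuousLinearMap.id ℝ E) (w : E) :
    ∃ ρ > 0, ball p ρ ⊆ Ω ∧ ∃ u : E → E, ContDiffOn ℝ ∞ u (ball p ρ) ∧ u p = w ∧
      ∀ x ∈ ball p ρ, ∀ a b, fderiv ℝ g x (u x) a b + g x (fderiv ℝ u x a) b
        + g x a (fderiv ℝ u x b) = 0 := by
  have hpr : p ∈ ball p r := mem_ball_self hr
  have hBK : ball p r ⊆ closedBall p R :=
    ball_subset_closedBall.trans (closedBall_subset_closedBall hrR)
  obtain ⟨C0, hC0, hC0b⟩ := hg.exists_bound_fderiv (isCompact_closedBall p R) hR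
  set Kc : Set (E × E × (E →L[ℝ] E)) :=
    closedBall p R ×ˢ closedBall p R ×ˢ closedBall 0 C0 with hKcdef
  have hKc : IsCompact Kc :=
    (isCompact_closedBall _ _).prod ((isCompact_closedBall _ _).prod (isCompact_closedBall _ _))
  have hKcc : Convex ℝ Kc :=
    (convex_closedBall _ _).prod ((convex_closedBall _ _).prod (convex_closedBall _ _))
  have hKO : Kc ⊆ Ω ×ˢ Ω ×ˢ univ := prod_mono hR (prod_mono hR (subset_univ _))
  have hO : IsOpen (Ω ×ˢ Ω ×ˢ (univ : Set (E →L[ℝ] E))) :=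
    hg.isOpen.prod (hg.isOpen.prod isOpen_univ)
  have hG := hg.contDiffOn_isometryJetRHS
  obtain ⟨C1, hC1⟩ := hKc.exists_bound_of_continuousOn (hG.continuousOn.mono hKO)
  have hjet : ∀ (f : E → E) (B : Set E), IsLocalIsometry g f B (closedBall p R) →
      B ⊆ closedBall p R → ∀ x ∈ B, (x, f x, fderiv ℝ f x) ∈ Kc ∧
        HasFDerivAt (fun y ↦ (f y, fderiv ℝ f y)) (isometryJetRHS g (x, f x, fderiv ℝ f x)) x :=
    fun f B hf hB x hx ↦ ⟨⟨hB hx, hf.mapsTo hx, by simpa using hC0b f B hf hB x hx⟩,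
      hf.hasFDerivAt_jet hg (hB.trans hR) hR hx⟩
  have hC1' : ∀ z ∈ Kc, ‖isometryHessian g z‖ ≤ C1 := fun z hz ↦ by
    refine opNorm_le_bound _ ((norm_nonneg _).trans (hC1 z hz)) fun v ↦ ?_
    calc ‖isometryHessian g z v‖ ≤ ‖isometryJetRHS g z v‖ := le_max_right _ _
      _ ≤ ‖isometryJetRHS g z‖ * ‖v‖ := le_opNorm _ _
      _ ≤ _ := by gcongr; exact hC1 z hz
  have hsym : ∀ q ∈ ball p r, ‖fderiv ℝ (σ q) p + ContinuousLinearMap.id ℝ E‖ ≤ C1 * ‖p - q‖ ∧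
      ‖σ q p - q + (p - q)‖ ≤ C1 * ‖p - q‖ ^ 2 := fun q hq ↦ by
    obtain ⟨hi, hqq, hdq⟩ := hσ q hq
    have hj := hjet _ _ hi hBK
    exact norm_symmetry_sub_le (convex_ball p r)
      (fun x hx ↦ (hi.smooth.contDiffAt (isOpen_ball.mem_nhds hx)).differentiableAt (by simp))
      (fun x hx ↦ (hj x hx).2.snd) (fun x hx ↦ hC1' _ (hj x hx).1) hpr hq hqq hdq
  obtain ⟨hip, hpp, hdp⟩ := hσ p hpr
  -- On the smaller ball the symmetry at `p` takes values where all the other symmetries are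
  -- defined, so they can be composed.
  obtain ⟨ρ, hρ, hρr, hρm⟩ : ∃ ρ > 0, ρ ≤ r ∧ MapsTo (σ p) (ball p ρ) (ball p r) := by
    have : (σ p) ⁻¹' ball p r ∈ 𝓝 p :=
      (hip.smooth.contDiffAt (isOpen_ball.mem_nhds hpr)).continuousAt.preimage_mem_nhds
        (by rw [hpp]; exact ball_mem_nhds p hr)
    obtain ⟨ρ, hρ, h⟩ := Metric.mem_nhds_iff.1 this
    exact ⟨min ρ r, lt_min hρ hr, min_le_right _ _,
      fun x hx ↦ h (ball_subset_ball (min_le_left _ _) hx)⟩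
  have hρb : ball p ρ ⊆ ball p r := ball_subset_ball hρr
  -- The factor `r / (‖w‖ + 1)` keeps every centre `q k` below inside the ball. The half in `q k`
  -- appears because a symmetry at `q` sends `p` to `2 q - p` up to second order, doubling the
  -- displacement.
  set t : ℕ → ℝ := fun k ↦ r / (‖w‖ + 1) * (1 / ((k : ℝ) + 1)) with htdef
  have ht : ∀ k, 0 < t k := fun k ↦ by positivity
  have ht0 : Tendsto t atTop (𝓝 0) := by
    simpa only [mul_zero] using tendsto_one_div_add_atTop_nhds_zero_nat.const_mul (r / (‖w‖ + 1))
  set q : ℕ → E := fun k ↦ p + (t k / 2) • w with hqdef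
  have hqp : ∀ k, ‖p - q k‖ = t k / 2 * ‖w‖ := fun k ↦ by
    rw [hqdef]
    simp only [sub_add_cancel_left, norm_neg, norm_smul]
    rw [Real.norm_of_nonneg (half_pos (ht k)).le]
  have hq : ∀ k, q k ∈ ball p r := fun k ↦ by
    rw [mem_ball, dist_eq_norm, ← norm_neg, neg_sub, hqp]
    have h1 : t k ≤ r / (‖w‖ + 1) := by
      rw [htdef]
      refine mul_le_of_le_one_right (by positivity) ?_
      rw [div_le_one (by positivity)]
      linarith [Nat.cast_nonneg (α := ℝ) k]
    rw [le_div_iff₀ (by positivity)] at h1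
    nlinarith [ht k, norm_nonneg w]
  set f : ℕ → E → E := fun k ↦ σ (q k) ∘ σ p with hfdef
  have hf : ∀ k, IsLocalIsometry g (f k) (ball p ρ) (closedBall p R) := fun k ↦
    (hσ _ (hq k)).1.comp (hip.mono hρb isOpen_ball) hρm
  have hid : IsLocalIsometry g id (ball p ρ) (closedBall p R) :=
    isLocalIsometry_id isOpen_ball (hρb.trans hBK)
  have hfp : ∀ k, f k p = σ (q k) p := fun k ↦ by rw [hfdef]; simp [hpp]
  have hdfp : ∀ k, fderiv ℝ (f k) p = -fderiv ℝ (σ (q k)) p := fun k ↦ by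
    rw [hfdef]
    have hd : ∀ q ∈ ball p r, DifferentiableAt ℝ (σ q) p := fun q hq ↦
      ((hσ q hq).1.smooth.contDiffAt (isOpen_ball.mem_nhds hpr)).differentiableAt (by simp)
    rw [fderiv_comp p (by rw [hpp]; exact hd _ (hq k)) (hd p hpr), hdp, hpp]
    ext; simp
  -- With `d = ‖p - q k‖ ≤ r`, the value moves by at most `C1 d² + 2 d` and the differential differs
  -- from the identity by at most `C1 d`; both are at most `(C1 (r + 1) + 2) d`.
  obtain ⟨Z, hZs, hZ⟩ := exists_linearised_solution hO hG hKc hKcc hKO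
    (p := p) (r := ρ) (j₀ := fun y ↦ (id y, fderiv ℝ id y))
    (j := fun k y ↦ (f k y, fderiv ℝ (f k) y)) (hjet _ _ hid (hρb.trans hBK))
    (fun k ↦ hjet _ _ (hf k) (hρb.trans hBK)) ht ht0 (C := (C1 * (r + 1) + 2) * ‖w‖) (fun k ↦ by
      obtain ⟨h1, h2⟩ := hsym _ (hq k)
      have hC1n : 0 ≤ C1 := (norm_nonneg _).trans (hC1' _ (hjet _ _ hip hBK p hpr).1)
      have hqr : ‖p - q k‖ ≤ r := by
        rw [← dist_eq_norm, dist_comm]; exact (mem_ball.1 (hq k)).le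
      have hb : (C1 * (r + 1) + 2) * ‖p - q k‖ ≤ (C1 * (r + 1) + 2) * ‖w‖ * t k := by
        rw [hqp, mul_assoc]
        have h3 : t k / 2 * ‖w‖ ≤ ‖w‖ * t k := by nlinarith [norm_nonneg w, ht k]
        exact mul_le_mul_of_nonneg_left h3 (by positivity)
      rw [Prod.mk_sub_mk, Prod.norm_mk, hfp, hdfp]
      refine le_trans (max_le ?_ ?_) hb
      · have : σ (q k) p - id p = (σ (q k) p - q k + (p - q k)) - (2 : ℝ) • (p - q k) := by
          simp only [id]; module
        rw [this]
        refine (norm_sub_le _ _).trans ?_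
        rw [norm_smul, Real.norm_of_nonneg zero_le_two]
        nlinarith [norm_nonneg (p - q k), mul_nonneg hC1n (norm_nonneg (p - q k))]
      · rw [fderiv_id, ← neg_add', norm_neg]
        refine h1.trans ?_
        gcongr
        nlinarith)
  refine ⟨ρ, hρ, (hρb.trans hBK).trans hR, fun x ↦ (Z x).1, hZs.fst, ?_, fun x hx a b ↦ ?_⟩
  · have h1 := ((hZ p (mem_ball_self hρ)).2).fst_nhds
    refine tendsto_nhds_unique h1 ?_
    have hle : (hyperfilter ℕ : Filter ℕ) ≤ atTop := by
      rw [← Nat.cofinite_eq_atTop]; exact hyperfilter_le_cofinite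
    refine Tendsto.mono_left ?_ hle
    rw [tendsto_iff_norm_sub_tendsto_zero]
    refine squeeze_zero (g := fun k ↦ C1 * ‖w‖ ^ 2 / 4 * t k) (fun _ ↦ norm_nonneg _) (fun k ↦ ?_)
      (by simpa using ht0.const_mul (C1 * ‖w‖ ^ 2 / 4))
    have h2 := (hsym _ (hq k)).2
    have : (t k)⁻¹ • (σ (q k) p - p) - w = (t k)⁻¹ • (σ (q k) p - q k + (p - q k)) := by
      have e : σ (q k) p - q k + (p - q k) = (σ (q k) p - p) - t k • w := by
        rw [show q k = p + (t k / 2) • w from rfl]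
        module
      rw [e, smul_sub (t k)⁻¹ (σ (q k) p - p), inv_smul_smul₀ (ht k).ne']
    simp only [Prod.smul_fst, Prod.fst_sub, hfp, id]
    rw [this, norm_smul, norm_inv, Real.norm_of_nonneg (ht k).le, inv_mul_le_iff₀ (ht k)]
    refine h2.trans_eq ?_
    rw [hqp]; ring
  · obtain ⟨hZd, hZl⟩ := hZ x hx
    have hxΩ : x ∈ Ω := hR (hBK (hρb hx))
    have hu : ∀ v, fderiv ℝ (fun x ↦ (Z x).1) x v = (Z x).2 v := fun v ↦ by
      rw [hZd.fst.fderiv]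
      have hz : (x, id x, fderiv ℝ id x) ∈ Ω ×ˢ Ω ×ˢ (univ : Set (E →L[ℝ] E)) :=
        ⟨hxΩ, hxΩ, mem_univ _⟩
      exact fderiv_isometryJetRHS_fst
        ((hG.contDiffAt (hO.mem_nhds hz)).differentiableAt (by simp)) (0, Z x) v
    rw [hu, hu]
    have hgx : DifferentiableAt ℝ g x :=
      (hg.smooth.contDiffAt (hg.isOpen.mem_nhds hxΩ)).differentiableAt (by simp)
    -- This function of the jet takes the value `g x a b` on the jet of every `f k` at `x`. Its
    -- derivative at the identity jet in the limit direction `Z x` thus vanishes, which is the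
    -- Killing equation.
    have hΨ : HasFDerivAt (fun z : E × (E →L[ℝ] E) ↦ g z.1 (z.2 a) (z.2 b)) _
        (x, ContinuousLinearMap.id ℝ E) :=
      (((hgx.hasFDerivAt.comp (x, ContinuousLinearMap.id ℝ E) hasFDerivAt_fst :
        HasFDerivAt (fun z : E × (E →L[ℝ] E) ↦ g z.1) _ _)).clm_apply
        (hasFDerivAt_snd.clm_apply (hasFDerivAt_const a _))).clm_apply
        (hasFDerivAt_snd.clm_apply (hasFDerivAt_const b _))
    have hle : (hyperfilter ℕ : Filter ℕ) ≤ atTop := by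
      rw [← Nat.cofinite_eq_atTop]; exact hyperfilter_le_cofinite
    have hd0 : Tendsto (fun k ↦ (f k x, fderiv ℝ (f k) x) - (x, ContinuousLinearMap.id ℝ E))
        (hyperfilter ℕ) (𝓝 0) := by
      have := (ht0.mono_left hle).smul hZl
      rw [zero_smul] at this
      refine this.congr fun k ↦ ?_
      rw [smul_inv_smul₀ (ht k).ne', id, fderiv_id]
    have hlim := hΨ.hasFDerivWithinAt (s := univ) |>.lim (l := (hyperfilter ℕ : Filter ℕ)) hd0
      (c := fun k ↦ (t k)⁻¹)
      (v := Z x) (by simp) (by simpa only [id, fderiv_id] using hZl)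
    have h0 : ∀ k, (t k)⁻¹ • (g (f k x) (fderiv ℝ (f k) x a) (fderiv ℝ (f k) x b) - g x a b)
        = 0 := fun k ↦ by rw [(hf k).isom x hx, sub_self, smul_zero]
    simp only [add_sub_cancel, ContinuousLinearMap.id_apply, h0] at hlim
    have := tendsto_nhds_unique hlim tendsto_const_nhds
    simp at this
    linarith
end CoordinateKilling

/-! ### Algebra of the Levi-Civita derivative given by the Koszul formula -/

section LeviCivita

open VectorField Filter Topology

variable {n : ℕ} {M : Type*} [TopologicalSpace M] [ChartedSpace (EuclideanSpace ℝ (Fin n)) M]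
  [IsManifold (𝓡 n) ∞ M]

/-- The vector field `X` is differentiable at `x`. -/
def DiffAt (X : VField n M) (x : M) : Prop :=
  MDifferentiableAt (𝓡 n) (𝓡 n).tangent (fun y ↦ (⟨y, X y⟩ : TangentBundle (𝓡 n) M)) x

theorem SmoothOn.diffAt {X : VField n M} {U : Set M} {x : M} (h : SmoothOn X U) (hU : U ∈ 𝓝 x) :
    DiffAt X x :=
  (h.contMDiffAt hU).mdifferentiableAt (by simp)

theorem contMDiffAt_ext {x : M} (v : TangentSpace (𝓡 n) x) :
    ContMDiffAt (𝓡 n) (𝓡 n).tangent ∞ (fun y ↦ (⟨y, ext v y⟩ : TangentBundle (𝓡 n) M)) x :=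
  FiberBundle.contMDiffAt_extend (𝓡 n) (EuclideanSpace ℝ (Fin n)) v

theorem diffAt_ext {x : M} (v : TangentSpace (𝓡 n) x) : DiffAt (ext v) x :=
  (contMDiffAt_ext v).mdifferentiableAt (by simp)

theorem ext_self {x : M} (v : TangentSpace (𝓡 n) x) : ext v x = v :=
  FiberBundle.extend_apply_self _ v

/-- The extension is constant in a trivialization, so its germ at `x` depends linearly on `v`. -/
theorem ext_eq_symmL {x : M} (v : TangentSpace (𝓡 n) x) {y : M}
    (hy : y ∈ (trivializationAt (EuclideanSpace ℝ (Fin n)) (TangentSpace (𝓡 n)) x).baseSet) :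
    ext v y = (trivializationAt (EuclideanSpace ℝ (Fin n)) (TangentSpace (𝓡 n)) x).symmL ℝ y
      ((trivializationAt (EuclideanSpace ℝ (Fin n)) (TangentSpace (𝓡 n)) x).continuousLinearMapAt
        ℝ x v) := by
  rw [Trivialization.continuousLinearMapAt_apply,
    Trivialization.linearMapAt_apply, if_pos (FiberBundle.mem_baseSet_trivializationAt' x),
    Trivialization.symmL_apply _ hy]
  rfl

theorem eventually_mem_baseSet (x : M) : ∀ᶠ y in 𝓝 x,
    y ∈ (trivializationAt (EuclideanSpace ℝ (Fin n)) (TangentSpace (𝓡 n)) x).baseSet :=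
  (trivializationAt (EuclideanSpace ℝ (Fin n)) (TangentSpace (𝓡 n)) x).open_baseSet.mem_nhds
    (FiberBundle.mem_baseSet_trivializationAt' x)

theorem ext_add {x : M} (v w : TangentSpace (𝓡 n) x) :
    (ext (v + w) : VField n M) =ᶠ[𝓝 x] ext v + ext w := by
  filter_upwards [eventually_mem_baseSet (n := n) x] with y hy
  simp only [ext_eq_symmL _ hy, Pi.add_apply, map_add]
  rfl

theorem ext_smul {x : M} (c : ℝ) (v : TangentSpace (𝓡 n) x) :
    (ext (c • v) : VField n M) =ᶠ[𝓝 x] c • ext v := by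
  filter_upwards [eventually_mem_baseSet (n := n) x] with y hy
  simp only [ext_eq_symmL _ hy, Pi.smul_apply, map_smul]
  rfl

theorem DiffAt.add {X Y : VField n M} {x : M} (hX : DiffAt X x) (hY : DiffAt Y x) :
    DiffAt (X + Y) x :=
  mdifferentiableAt_add_section hX hY

theorem DiffAt.smul {X : VField n M} {f : M → ℝ} {x : M} (hf : MDifferentiableAt (𝓡 n) 𝓘(ℝ) f x)
    (hX : DiffAt X x) : DiffAt (f • X) x :=
  MDifferentiableAt.smul_section hf hX

theorem DiffAt.const_smul {X : VField n M} (c : ℝ) {x : M} (hX : DiffAt X x) : DiffAt (c • X) x :=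
  MDifferentiableAt.smul_section (mdifferentiableAt_const (c := c)) hX

variable [RiemannianBundle (fun x : M ↦ TangentSpace (𝓡 n) x)]

section Algebra

variable (X Y Z : VField n M) (f : M → ℝ)

theorem metric_comm : metric X Y = metric Y X := funext fun _ ↦ real_inner_comm _ _

theorem metric_add_left : metric (X + Y) Z = metric X Z + metric Y Z :=
  funext fun _ ↦ inner_add_left _ _ _

theorem metric_add_right : metric X (Y + Z) = metric X Y + metric X Z :=
  funext fun _ ↦ inner_add_right _ _ _

theorem metric_smul_left : metric (f • X) Y = f * metric X Y :=
  funext fun _ ↦ real_inner_smul_left _ _ _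

theorem metric_smul_right : metric X (f • Y) = f * metric X Y :=
  funext fun _ ↦ real_inner_smul_right _ _ _

end Algebra

variable [IsContMDiffRiemannianBundle (𝓡 n) ∞ (EuclideanSpace ℝ (Fin n))
      (fun x : M ↦ TangentSpace (𝓡 n) x)]

theorem DiffAt.metric {X Y : VField n M} {x : M} (hX : DiffAt X x) (hY : DiffAt Y x) :
    MDifferentiableAt (𝓡 n) 𝓘(ℝ) (metric X Y) x :=
  MDifferentiableAt.inner_bundle (F := EuclideanSpace ℝ (Fin n))
    (E := fun x : M ↦ TangentSpace (𝓡 n) x) hX hY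

variable {X Y Y' Z Z' : VField n M} {x : M}

theorem koszul_add_mid (hX : DiffAt X x) (hY : DiffAt Y x) (hY' : DiffAt Y' x) (hZ : DiffAt Z x) :
    koszul X (Y + Y') Z x = koszul X Y Z x + koszul X Y' Z x := by
  simp only [koszul, metric_add_left, metric_add_right]
  rw [mvfderiv_add (hY.metric hZ) (hY'.metric hZ), mvfderiv_add (hX.metric hY) (hX.metric hY')]
  simp only [metric, mlieBracket_add_right hY hY', mlieBracket_add_left hY hY', Pi.add_apply,
    map_add, inner_add_left, add_apply]
  ring

/-- The terms with the derivative of `f` along `Z` cancel; the two along `X` add up, absorbing the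
factor one half. -/
theorem koszul_smul_mid {f : M → ℝ} (hf : MDifferentiableAt (𝓡 n) 𝓘(ℝ) f x)
    (hX : DiffAt X x) (hY : DiffAt Y x) (hZ : DiffAt Z x) :
    koszul X (f • Y) Z x
      = f x * koszul X Y Z x + mvfderiv (𝓡 n) f x (X x) * inner ℝ (Y x) (Z x) := by
  simp only [koszul]
  rw [metric_smul_left, metric_smul_right X, mvfderiv_mul hf (hY.metric hZ),
    mvfderiv_mul hf (hX.metric hY)]
  simp only [metric, mlieBracket_smul_right hf hY, mlieBracket_smul_left hf hY, Pi.smul_apply',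
    map_smul, inner_add_left, real_inner_smul_left, real_inner_smul_right, smul_eq_mul,
    add_apply, smul_apply, inner_neg_left, neg_smul]
  rw [real_inner_comm (X x) (Y x)]
  ring

theorem koszul_add_right (hX : DiffAt X x) (hY : DiffAt Y x) (hZ : DiffAt Z x)
    (hZ' : DiffAt Z' x) :
    koszul X Y (Z + Z') x = koszul X Y Z x + koszul X Y Z' x := by
  simp only [koszul, metric_add_right]
  rw [mvfderiv_add (hY.metric hZ) (hY.metric hZ'), mvfderiv_add (hX.metric hZ) (hX.metric hZ')]
  simp only [metric, mlieBracket_add_right hZ hZ', Pi.add_apply,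
    map_add, inner_add_left, add_apply]
  ring

theorem koszul_const_smul_right (c : ℝ) (hX : DiffAt X x) (hY : DiffAt Y x) (hZ : DiffAt Z x) :
    koszul X Y (c • Z) x = c * koszul X Y Z x := by
  have hc : c • Z = (fun _ : M ↦ c) • Z := rfl
  have hf : MDifferentiableAt (𝓡 n) 𝓘(ℝ) (fun _ : M ↦ c) x := mdifferentiableAt_const
  simp only [koszul, mlieBracket_const_smul_right hZ, metric]
  rw [hc]
  change 1 / 2 * (mvfderiv (𝓡 n) (RiemannianTensor.metric Y ((fun _ : M ↦ c) • Z)) x (X x)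
    + mvfderiv (𝓡 n) (RiemannianTensor.metric X ((fun _ : M ↦ c) • Z)) x (Y x) - _ + _ - _ - _) = _
  rw [metric_smul_right, metric_smul_right, mvfderiv_mul hf (hY.metric hZ),
    mvfderiv_mul hf (hX.metric hZ)]
  simp only [mvfderiv_const, Pi.smul_apply', map_smul,
    real_inner_smul_left, real_inner_smul_right, smul_eq_mul, smul_apply, smul_zero, add_zero]
  ring

theorem mvfderiv_congr {f g : M → ℝ} (h : f =ᶠ[𝓝 x] g) :
    mvfderiv (𝓡 n) f x = mvfderiv (𝓡 n) g x := by
  ext v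
  have := h.mfderiv_eq (I := 𝓡 n) (I' := 𝓘(ℝ))
  exact DFunLike.congr_fun this v

theorem koszul_congr_mid (h : Y =ᶠ[𝓝 x] Y') : koszul X Y Z x = koszul X Y' Z x := by
  have h1 : metric Y Z =ᶠ[𝓝 x] metric Y' Z := h.mono fun y hy ↦ by simp only [metric, hy]
  have h2 : metric X Y =ᶠ[𝓝 x] metric X Y' := h.mono fun y hy ↦ by simp only [metric, hy]
  have h3 := h.mlieBracket_vectorField_eq (EventuallyEq.refl (𝓝 x) Z) (I := 𝓡 n)
  have h4 := (EventuallyEq.refl (𝓝 x) X).mlieBracket_vectorField_eq h (I := 𝓡 n)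
  have h5 : Y x = Y' x := h.self_of_nhds
  simp only [koszul, mvfderiv_congr h1, mvfderiv_congr h2]
  simp only [metric, h3, h4, h5]

theorem koszul_congr_right (h : Z =ᶠ[𝓝 x] Z') : koszul X Y Z x = koszul X Y Z' x := by
  have h1 : metric Y Z =ᶠ[𝓝 x] metric Y Z' := h.mono fun y hy ↦ by simp only [metric, hy]
  have h2 : metric X Z =ᶠ[𝓝 x] metric X Z' := h.mono fun y hy ↦ by simp only [metric, hy]
  have h3 := (EventuallyEq.refl (𝓝 x) X).mlieBracket_vectorField_eq h (I := 𝓡 n)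
  have h4 := (EventuallyEq.refl (𝓝 x) Y).mlieBracket_vectorField_eq h (I := 𝓡 n)
  have h5 : Z x = Z' x := h.self_of_nhds
  simp only [koszul, mvfderiv_congr h1, mvfderiv_congr h2]
  simp only [metric, h3, h4, h5]

/-- Since `ext w` is linear in `w` up to germs, the Koszul expression is a linear form in `w`,
recovered from its values on the orthonormal basis. -/
theorem inner_leviCivita (hY : DiffAt Y x) (v w : TangentSpace (𝓡 n) x) :
    inner ℝ (leviCivita Y v) w = koszul (ext v) Y (ext w) x := by
  have hv := diffAt_ext v
  let L : TangentSpace (𝓡 n) x →ₗ[ℝ] ℝ :=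
    { toFun := fun w ↦ koszul (ext v) Y (ext w) x
      map_add' := fun a b ↦ by
        rw [koszul_congr_right (ext_add a b), koszul_add_right hv hY (diffAt_ext a) (diffAt_ext b)]
      map_smul' := fun c a ↦ by
        rw [koszul_congr_right (ext_smul c a), koszul_const_smul_right c hv hY (diffAt_ext a)]
        rfl }
  have hL : ∀ w, koszul (ext v) Y (ext w) x = L w := fun _ ↦ rfl
  simp only [leviCivita, hL, sum_inner, real_inner_smul_left]
  conv_rhs => rw [← (onb x).sum_repr w, map_sum]
  refine Finset.sum_congr rfl fun i _ ↦ ?_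
  rw [map_smul, smul_eq_mul, OrthonormalBasis.repr_apply_apply, mul_comm]

theorem leviCivita_congr (h : Y =ᶠ[𝓝 x] Y') (v : TangentSpace (𝓡 n) x) :
    leviCivita Y v = leviCivita Y' v := by
  simp only [leviCivita, koszul_congr_mid h]

theorem leviCivita_add (hY : DiffAt Y x) (hY' : DiffAt Y' x) (v : TangentSpace (𝓡 n) x) :
    leviCivita (Y + Y') v = leviCivita Y v + leviCivita Y' v := by
  simp only [leviCivita, koszul_add_mid (diffAt_ext v) hY hY' (diffAt_ext _), add_smul,
    Finset.sum_add_distrib]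

theorem leviCivita_smul {f : M → ℝ} (hf : MDifferentiableAt (𝓡 n) 𝓘(ℝ) f x) (hY : DiffAt Y x)
    (v : TangentSpace (𝓡 n) x) :
    leviCivita (f • Y) v = mvfderiv (𝓡 n) f x v • Y x + f x • leviCivita Y v := by
  simp only [leviCivita, koszul_smul_mid hf (diffAt_ext v) hY (diffAt_ext _), add_smul,
    Finset.sum_add_distrib, mul_smul, ext_self, ← Finset.smul_sum]
  rw [add_comm]
  congr 2
  conv_rhs => rw [← (onb x).sum_repr (Y x)]
  refine Finset.sum_congr rfl fun i _ ↦ ?_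
  rw [OrthonormalBasis.repr_apply_apply, real_inner_comm]

theorem leviCivita_zero (v : TangentSpace (𝓡 n) x) : leviCivita (0 : VField n M) v = 0 := by
  have h0 : DiffAt (0 : VField n M) x := by
    have := (diffAt_ext v).const_smul 0
    rwa [zero_smul] at this
  have := leviCivita_add h0 h0 v
  rwa [add_zero, left_eq_add] at this

theorem leviCivita_sum {ι : Type*} (s : Finset ι) (Y : ι → VField n M)
    (hY : ∀ i ∈ s, DiffAt (Y i) x) (v : TangentSpace (𝓡 n) x) :
    DiffAt (∑ i ∈ s, Y i) x ∧ leviCivita (∑ i ∈ s, Y i) v = ∑ i ∈ s, leviCivita (Y i) v := by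
  classical
  induction s using Finset.induction_on with
  | empty =>
    refine ⟨?_, by simpa using leviCivita_zero v⟩
    have := (diffAt_ext v).const_smul 0
    rwa [zero_smul] at this
  | insert a s ha ih =>
    obtain ⟨h1, h2⟩ := ih fun i hi ↦ hY i (Finset.mem_insert_of_mem hi)
    have h3 := hY a (Finset.mem_insert_self _ _)
    rw [Finset.sum_insert ha, Finset.sum_insert ha, leviCivita_add h3 h1, h2]
    exact ⟨h3.add h1, rfl⟩

/-- The Lie derivative of the metric: twice the symmetric part of the covariant derivative. -/
theorem koszul_add_koszul_swap (X Y Z : VField n M) (x : M) :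
    koszul X Y Z x + koszul Z Y X x = mvfderiv (𝓡 n) (metric X Z) x (Y x)
      + metric (mlieBracket (𝓡 n) X Y) Z x + metric (mlieBracket (𝓡 n) Z Y) X x := by
  simp only [koszul, metric_comm Y, metric_comm Z X]
  simp only [metric, mlieBracket_swap_apply (V := Y), mlieBracket_swap_apply (V := Z) (W := X), 
    inner_neg_left]
  ring

/-- The right-hand side is the Lie derivative of the metric along `Y`, which can be computed in a
chart without Christoffel symbols. -/
theorem inner_leviCivita_add_inner (hY : DiffAt Y x) (v w : TangentSpace (𝓡 n) x) :
    inner ℝ (leviCivita Y v) w + inner ℝ v (leviCivita Y w)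
      = mvfderiv (𝓡 n) (metric (ext v) (ext w)) x (Y x)
      + metric (mlieBracket (𝓡 n) (ext v) Y) (ext w) x
      + metric (mlieBracket (𝓡 n) (ext w) Y) (ext v) x := by
  rw [real_inner_comm _ v, inner_leviCivita hY, inner_leviCivita hY, koszul_add_koszul_swap]

end LeviCivita

/-! ### Vector fields, brackets and the metric in a chart -/

section Chart

open VectorField Filter Topology Set

variable {n : ℕ} {M : Type*} [TopologicalSpace M] [ChartedSpace (EuclideanSpace ℝ (Fin n)) M]
  [IsManifold (𝓡 n) ∞ M]

/-- The derivative of the inverse of the chart at `p`, at the point with coordinates `y`. -/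
def chartSymmDeriv (p : M) (y : EuclideanSpace ℝ (Fin n)) :
    EuclideanSpace ℝ (Fin n) →L[ℝ]
      TangentSpace (𝓡 n) ((chartAt (EuclideanSpace ℝ (Fin n)) p).symm y) :=
  mfderiv (𝓡 n) (𝓡 n) (chartAt (EuclideanSpace ℝ (Fin n)) p).symm y

/-- The derivative of the chart at `p`, at the point `x`. -/
def chartDeriv (p x : M) : TangentSpace (𝓡 n) x →L[ℝ] EuclideanSpace ℝ (Fin n) :=
  mfderiv (𝓡 n) (𝓡 n) (chartAt (EuclideanSpace ℝ (Fin n)) p) x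

/-- The coordinate expression of a vector field in the chart at `p`. -/
def coordRep (p : M) (X : VField n M) (y : EuclideanSpace ℝ (Fin n)) : EuclideanSpace ℝ (Fin n) :=
  mpullback (𝓡 n) (𝓡 n) (chartAt (EuclideanSpace ℝ (Fin n)) p).symm X y

/-- The vector field with given coordinate expression in the chart at `p`. -/
def fieldOfCoord (p : M) (u : EuclideanSpace ℝ (Fin n) → EuclideanSpace ℝ (Fin n)) : VField n M :=
  mpullback (𝓡 n) (𝓡 n) (chartAt (EuclideanSpace ℝ (Fin n)) p) u

variable {p : M} {y : EuclideanSpace ℝ (Fin n)}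

theorem chartDeriv_chartSymmDeriv (hy : y ∈ (chartAt (EuclideanSpace ℝ (Fin n)) p).target)
    (a : EuclideanSpace ℝ (Fin n)) :
    chartDeriv p ((chartAt (EuclideanSpace ℝ (Fin n)) p).symm y) (chartSymmDeriv p y a) = a :=
  DFunLike.congr_fun ((mdifferentiable_chart (I := 𝓡 n) p).comp_symm_deriv hy) a

theorem isInvertible_chartSymmDeriv (hy : y ∈ (chartAt (EuclideanSpace ℝ (Fin n)) p).target) :
    (mfderiv (𝓡 n) (𝓡 n) (chartAt (EuclideanSpace ℝ (Fin n)) p).symm y).IsInvertible :=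
  ⟨(mdifferentiable_chart (I := 𝓡 n) p).symm.mfderiv hy, rfl⟩

theorem isInvertible_chartDeriv {x : M} (hx : x ∈ (chartAt (EuclideanSpace ℝ (Fin n)) p).source) :
    (mfderiv (𝓡 n) (𝓡 n) (chartAt (EuclideanSpace ℝ (Fin n)) p) x).IsInvertible :=
  ⟨(mdifferentiable_chart (I := 𝓡 n) p).mfderiv hx, rfl⟩

theorem chartSymmDeriv_coordRep (hy : y ∈ (chartAt (EuclideanSpace ℝ (Fin n)) p).target)
    (X : VField n M) :
    chartSymmDeriv p y (coordRep p X y) = X ((chartAt (EuclideanSpace ℝ (Fin n)) p).symm y) :=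
  (isInvertible_chartSymmDeriv hy).self_apply_inverse _

theorem chartSymmDeriv_injective (hy : y ∈ (chartAt (EuclideanSpace ℝ (Fin n)) p).target) :
    Function.Injective (chartSymmDeriv p y) :=
  (isInvertible_chartSymmDeriv hy).injective

theorem chartSymmDeriv_chartDeriv (hy : y ∈ (chartAt (EuclideanSpace ℝ (Fin n)) p).target)
    (v : TangentSpace (𝓡 n) ((chartAt (EuclideanSpace ℝ (Fin n)) p).symm y)) :
    chartSymmDeriv p y (chartDeriv p ((chartAt (EuclideanSpace ℝ (Fin n)) p).symm y) v) = v := by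
  obtain ⟨a, rfl⟩ := (isInvertible_chartSymmDeriv hy).surjective v
  congr 1
  exact chartDeriv_chartSymmDeriv hy a

theorem fieldOfCoord_symm (hy : y ∈ (chartAt (EuclideanSpace ℝ (Fin n)) p).target)
    (u : EuclideanSpace ℝ (Fin n) → EuclideanSpace ℝ (Fin n)) :
    fieldOfCoord p u ((chartAt (EuclideanSpace ℝ (Fin n)) p).symm y)
      = chartSymmDeriv p y (u y) := by
  have hx := (chartAt (EuclideanSpace ℝ (Fin n)) p).map_target hy
  apply (isInvertible_chartDeriv hx).injective
  have h1 := (isInvertible_chartDeriv hx).self_apply_inverse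
    (u ((chartAt (EuclideanSpace ℝ (Fin n)) p)
      ((chartAt (EuclideanSpace ℝ (Fin n)) p).symm y)))
  have h2 := chartDeriv_chartSymmDeriv hy (u y)
  refine (h1.trans ?_).trans h2.symm
  rw [(chartAt (EuclideanSpace ℝ (Fin n)) p).right_inv hy]

theorem coordRep_fieldOfCoord (hy : y ∈ (chartAt (EuclideanSpace ℝ (Fin n)) p).target)
    (u : EuclideanSpace ℝ (Fin n) → EuclideanSpace ℝ (Fin n)) :
    coordRep p (fieldOfCoord p u) y = u y := by
  apply chartSymmDeriv_injective hy
  rw [chartSymmDeriv_coordRep hy, fieldOfCoord_symm hy]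

theorem contDiffAt_coordRep (hy : y ∈ (chartAt (EuclideanSpace ℝ (Fin n)) p).target)
    {X : VField n M} (hX : ContMDiffAt (𝓡 n) (𝓡 n).tangent ∞
      (fun x ↦ (⟨x, X x⟩ : TangentBundle (𝓡 n) M))
      ((chartAt (EuclideanSpace ℝ (Fin n)) p).symm y)) :
    ContDiffAt ℝ ∞ (coordRep p X) y := by
  have h1 : ContMDiffAt (𝓡 n) (𝓡 n) ∞ (chartAt (EuclideanSpace ℝ (Fin n)) p).symm y :=
    contMDiffOn_chart_symm.contMDiffAt
      ((chartAt (EuclideanSpace ℝ (Fin n)) p).open_target.mem_nhds hy)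
  have := hX.mpullback_vectorField_preimage h1 (isInvertible_chartSymmDeriv hy) (by simp)
  exact contMDiffAt_vectorSpace_iff_contDiffAt.1 this

theorem contMDiffAt_fieldOfCoord {x : M}
    (hx : x ∈ (chartAt (EuclideanSpace ℝ (Fin n)) p).source)
    {u : EuclideanSpace ℝ (Fin n) → EuclideanSpace ℝ (Fin n)}
    (hu : ContDiffAt ℝ ∞ u (chartAt (EuclideanSpace ℝ (Fin n)) p x)) :
    ContMDiffAt (𝓡 n) (𝓡 n).tangent ∞
      (fun x ↦ (⟨x, fieldOfCoord p u x⟩ : TangentBundle (𝓡 n) M)) x := by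
  have h1 : ContMDiffAt (𝓡 n) (𝓡 n) ∞ (chartAt (EuclideanSpace ℝ (Fin n)) p) x :=
    contMDiffOn_chart.contMDiffAt
      ((chartAt (EuclideanSpace ℝ (Fin n)) p).open_source.mem_nhds hx)
  exact (contMDiffAt_vectorSpace_iff_contDiffAt.2 hu).mpullback_vectorField_preimage h1
    (isInvertible_chartDeriv hx) (by simp)

theorem coordRep_mlieBracket (hy : y ∈ (chartAt (EuclideanSpace ℝ (Fin n)) p).target)
    {X Y : VField n M} (hX : DiffAt X ((chartAt (EuclideanSpace ℝ (Fin n)) p).symm y))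
    (hY : DiffAt Y ((chartAt (EuclideanSpace ℝ (Fin n)) p).symm y)) :
    coordRep p (mlieBracket (𝓡 n) X Y) y
      = fderiv ℝ (coordRep p Y) y (coordRep p X y)
        - fderiv ℝ (coordRep p X) y (coordRep p Y y) := by
  have h1 : ContMDiffAt (𝓡 n) (𝓡 n) ∞ (chartAt (EuclideanSpace ℝ (Fin n)) p).symm y :=
    contMDiffOn_chart_symm.contMDiffAt
      ((chartAt (EuclideanSpace ℝ (Fin n)) p).open_target.mem_nhds hy)
  have : IsManifold (𝓡 n) (minSmoothness ℝ 3) M := by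
    rw [minSmoothness_of_isRCLikeNormedField]; infer_instance
  have : IsManifold (𝓡 n) (minSmoothness ℝ 3) (EuclideanSpace ℝ (Fin n)) := by
    rw [minSmoothness_of_isRCLikeNormedField]; infer_instance
  have := mpullback_mlieBracket hX hY h1 (by
    rw [minSmoothness_of_isRCLikeNormedField]; exact WithTop.coe_le_coe.2 le_top)
  refine Eq.trans this ?_
  rw [← mlieBracketWithin_univ, mlieBracketWithin_eq_lieBracketWithin]
  change lieBracketWithin ℝ (coordRep p X) (coordRep p Y) univ y = _
  rw [lieBracketWithin_univ]
  rfl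

theorem mvfderiv_eq_fderiv_comp_symm (hy : y ∈ (chartAt (EuclideanSpace ℝ (Fin n)) p).target)
    {f : M → ℝ} (hf : MDifferentiableAt (𝓡 n) 𝓘(ℝ) f
      ((chartAt (EuclideanSpace ℝ (Fin n)) p).symm y)) (a : EuclideanSpace ℝ (Fin n)) :
    mvfderiv (𝓡 n) f ((chartAt (EuclideanSpace ℝ (Fin n)) p).symm y) (chartSymmDeriv p y a)
      = fderiv ℝ (fun z ↦ f ((chartAt (EuclideanSpace ℝ (Fin n)) p).symm z)) y a := by
  have h1 : MDifferentiableAt (𝓡 n) (𝓡 n) (chartAt (EuclideanSpace ℝ (Fin n)) p).symm y :=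
    (mdifferentiable_chart (I := 𝓡 n) p).mdifferentiableAt_symm hy
  have := mvfderiv_comp_apply y hf h1 a
  refine this.symm.trans ?_
  change mfderiv (𝓡 n) 𝓘(ℝ) _ y a = _
  rw [mfderiv_eq_fderiv]
  rfl

variable [RiemannianBundle (fun x : M ↦ TangentSpace (𝓡 n) x)]

/-- The coordinate expression of the Riemannian metric in the chart at `p`. -/
def coordMetric (p : M) (y : EuclideanSpace ℝ (Fin n)) :
    EuclideanSpace ℝ (Fin n) →L[ℝ] EuclideanSpace ℝ (Fin n) →L[ℝ] ℝ :=
  (LinearMap.mk₂ ℝ (fun a b ↦ inner ℝ (chartSymmDeriv p y a) (chartSymmDeriv p y b))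
    (fun a a' b ↦ by rw [map_add, inner_add_left])
    (fun c a b ↦ by rw [map_smul, real_inner_smul_left]; rfl)
    (fun a b b' ↦ by rw [map_add, inner_add_right])
    (fun c a b ↦ by rw [map_smul, real_inner_smul_right]; rfl)).toContinuousBilinearMap

theorem coordMetric_apply (p : M) (y a b : EuclideanSpace ℝ (Fin n)) :
    coordMetric p y a b = inner ℝ (chartSymmDeriv p y a) (chartSymmDeriv p y b) := rfl

theorem metric_symm (hy : y ∈ (chartAt (EuclideanSpace ℝ (Fin n)) p).target) (X Y : VField n M) :
    metric X Y ((chartAt (EuclideanSpace ℝ (Fin n)) p).symm y)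
      = coordMetric p y (coordRep p X y) (coordRep p Y y) := by
  rw [coordMetric_apply, chartSymmDeriv_coordRep hy, chartSymmDeriv_coordRep hy]
  rfl

variable [IsContMDiffRiemannianBundle (𝓡 n) ∞ (EuclideanSpace ℝ (Fin n))
      (fun x : M ↦ TangentSpace (𝓡 n) x)]

theorem isMetricOn_coordMetric (p : M) :
    IsMetricOn (coordMetric p) (chartAt (EuclideanSpace ℝ (Fin n)) p).target where
  isOpen := (chartAt (EuclideanSpace ℝ (Fin n)) p).open_target
  symm x _ v w := by
    rw [coordMetric_apply, coordMetric_apply]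
    exact real_inner_comm _ _
  pos x hx v hv := by
    rw [coordMetric_apply]
    exact real_inner_self_pos.2 fun h ↦ hv (chartSymmDeriv_injective hx (h.trans (map_zero _).symm))
  smooth := by
    simp only [contDiffOn_clm_apply]
    intro a b y hy
    have hx := (chartAt (EuclideanSpace ℝ (Fin n)) p).map_target hy
    have h : ∀ a : EuclideanSpace ℝ (Fin n), ContMDiffAt (𝓡 n) (𝓡 n).tangent ∞
      (fun x ↦ (⟨x, fieldOfCoord p (fun _ ↦ a) x⟩ : TangentBundle (𝓡 n) M))
      ((chartAt (EuclideanSpace ℝ (Fin n)) p).symm y) :=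
      fun a ↦ contMDiffAt_fieldOfCoord hx contDiffAt_const
    have h1 : ContMDiffAt (𝓡 n) 𝓘(ℝ) ∞ (metric (fieldOfCoord p (fun _ ↦ a))
        (fieldOfCoord p (fun _ ↦ b))) ((chartAt (EuclideanSpace ℝ (Fin n)) p).symm y) :=
      ContMDiffAt.inner_bundle (F := EuclideanSpace ℝ (Fin n))
        (E := fun x : M ↦ TangentSpace (𝓡 n) x) (h a) (h b)
    have h2 : ContMDiffAt (𝓡 n) (𝓡 n) ∞ (chartAt (EuclideanSpace ℝ (Fin n)) p).symm y :=
      contMDiffOn_chart_symm.contMDiffAt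
        ((chartAt (EuclideanSpace ℝ (Fin n)) p).open_target.mem_nhds hy)
    refine (((h1.comp y h2).contDiffAt).congr_of_eventuallyEq ?_).contDiffWithinAt
    filter_upwards [(chartAt (EuclideanSpace ℝ (Fin n)) p).open_target.mem_nhds hy] with z hz
    rw [Function.comp_apply, metric_symm hz, coordRep_fieldOfCoord hz, coordRep_fieldOfCoord hz]

/-- A vector field whose coordinate expression satisfies the Killing equation is Killing. -/
theorem isKillingOn_fieldOfCoord {B : Set (EuclideanSpace ℝ (Fin n))} (hB : IsOpen B)
    {u : EuclideanSpace ℝ (Fin n) → EuclideanSpace ℝ (Fin n)} (hu : ContDiffOn ℝ ∞ u B)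
    (hK : ∀ y ∈ B, ∀ a b, fderiv ℝ (coordMetric p) y (u y) a b
      + coordMetric p y (fderiv ℝ u y a) b + coordMetric p y a (fderiv ℝ u y b) = 0) :
    IsKillingOn (fieldOfCoord p u) ((chartAt (EuclideanSpace ℝ (Fin n)) p).source ∩
      chartAt (EuclideanSpace ℝ (Fin n)) p ⁻¹' B) where
  isOpen := (chartAt (EuclideanSpace ℝ (Fin n)) p).isOpen_inter_preimage hB
  smooth x hx := (contMDiffAt_fieldOfCoord hx.1
    (hu.contDiffAt (hB.mem_nhds hx.2))).contMDiffWithinAt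
  skew := by
    rintro x ⟨hx, hxB⟩ v w
    obtain ⟨y, hy, rfl⟩ : ∃ y ∈ (chartAt (EuclideanSpace ℝ (Fin n)) p).target,
      (chartAt (EuclideanSpace ℝ (Fin n)) p).symm y = x :=
      ⟨_, (chartAt (EuclideanSpace ℝ (Fin n)) p).map_source hx,
        (chartAt (EuclideanSpace ℝ (Fin n)) p).left_inv hx⟩
    have hyB : y ∈ B := by
      have := hxB
      rwa [mem_preimage, (chartAt (EuclideanSpace ℝ (Fin n)) p).right_inv hy] at this
    have hus : ContDiffAt ℝ ∞ u y := hu.contDiffAt (hB.mem_nhds hyB)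
    have hKd : DiffAt (fieldOfCoord p u) ((chartAt (EuclideanSpace ℝ (Fin n)) p).symm y) :=
      (contMDiffAt_fieldOfCoord hx (by
        rwa [(chartAt (EuclideanSpace ℝ (Fin n)) p).right_inv hy])).mdifferentiableAt (by simp)
    rw [inner_leviCivita_add_inner hKd, fieldOfCoord_symm hy,
      mvfderiv_eq_fderiv_comp_symm hy ((diffAt_ext v).metric (diffAt_ext w)),
      metric_symm hy, metric_symm hy, coordRep_mlieBracket hy (diffAt_ext v) hKd,
      coordRep_mlieBracket hy (diffAt_ext w) hKd, coordRep_fieldOfCoord hy]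
    have hnhds := (chartAt (EuclideanSpace ℝ (Fin n)) p).open_target.mem_nhds hy
    have hue : coordRep p (fieldOfCoord p u) =ᶠ[𝓝 y] u := by
      filter_upwards [hnhds] with z hz
      exact coordRep_fieldOfCoord hz u
    rw [hue.fderiv_eq]
    have hm : (fun z ↦ metric (ext v) (ext w) ((chartAt (EuclideanSpace ℝ (Fin n)) p).symm z))
        =ᶠ[𝓝 y] fun z ↦ coordMetric p z (coordRep p (ext v) z) (coordRep p (ext w) z) := by
      filter_upwards [hnhds] with z hz
      exact metric_symm hz _ _
    have hV := ((contDiffAt_coordRep hy (contMDiffAt_ext v)).differentiableAt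
      (by simp)).hasFDerivAt
    have hW := ((contDiffAt_coordRep hy (contMDiffAt_ext w)).differentiableAt
      (by simp)).hasFDerivAt
    have hg := ((((isMetricOn_coordMetric p).smooth.contDiffAt hnhds)).differentiableAt
      (by simp)).hasFDerivAt
    rw [hm.fderiv_eq, ((hg.clm_apply hV).clm_apply hW).fderiv]
    have hk := hK y hyB (coordRep p (ext v) y) (coordRep p (ext w) y)
    have hs := (isMetricOn_coordMetric p).symm y hy
    -- The derivatives of the extensions of `v` and `w` cancel between the metric term and the
    -- brackets; what remains is the coordinate Killing equation.
    simp only [map_sub, sub_apply, add_apply, ContinuousLinearMap.comp_apply,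
      ContinuousLinearMap.flip_apply]
    rw [hs (fderiv ℝ u y (coordRep p (ext w) y)), hs (fderiv ℝ (coordRep p (ext w)) y (u y))]
    linarith

end Chart

/-! ### Local Killing fields through every tangent vector of a symmetric space -/

section KillingFields

open VectorField Filter Topology Set Metric Manifold

variable {n : ℕ} {M : Type*} [TopologicalSpace M] [ChartedSpace (EuclideanSpace ℝ (Fin n)) M]
  [IsManifold (𝓡 n) ∞ M] [RiemannianBundle (fun x : M ↦ TangentSpace (𝓡 n) x)]
  [IsContMDiffRiemannianBundle (𝓡 n) ∞ (EuclideanSpace ℝ (Fin n))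
      (fun x : M ↦ TangentSpace (𝓡 n) x)]

/-- The differential of `s` preserves the Riemannian metric. -/
def PreservesMetric (s : M → M) : Prop :=
  ∀ (x : M) (v w : TangentSpace (𝓡 n) x),
    inner ℝ (mfderiv (𝓡 n) (𝓡 n) s x v) (mfderiv (𝓡 n) (𝓡 n) s x w) = inner ℝ v w

/-- The image of a path has the same length, and the distance is an infimum of lengths. -/
theorem PreservesMetric.riemannianEDist_le {s : M → M} (hs : PreservesMetric (n := n) s)
    (hd : ContMDiff (𝓡 n) (𝓡 n) ∞ s) (x y : M) :
    riemannianEDist (𝓡 n) (s x) (s y) ≤ riemannianEDist (𝓡 n) x y := by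
  refine le_of_forall_gt fun r hr ↦ ?_
  obtain ⟨γ, h0, h1, hγ, hl, -, -⟩ :=
    exists_lt_locally_constant_of_riemannianEDist_lt hr zero_lt_one
  have hsγ : ContMDiff 𝓘(ℝ, ℝ) (𝓡 n) 1 (s ∘ γ) := (hd.of_le (by norm_cast)).comp hγ
  refine lt_of_le_of_lt (riemannianEDist_le_pathELength (a := 0) (b := 1) hsγ.contMDiffOn
    (by simp [h0]) (by simp [h1]) zero_le_one) ?_
  convert hl using 1
  rw [pathELength_eq_lintegral_mfderiv_Icc, pathELength_eq_lintegral_mfderiv_Icc]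
  congr 1
  funext t
  have h2 := mfderiv_comp_apply t ((hd.mdifferentiable (by simp)) (γ t))
    ((hγ.mdifferentiable (by simp)) t) (1 : TangentSpace 𝓘(ℝ, ℝ) t)
  rw [h2, ← ofReal_norm, ← ofReal_norm, norm_eq_sqrt_real_inner, norm_eq_sqrt_real_inner]
  exact congrArg (fun r ↦ ENNReal.ofReal √r) (hs (γ t) _ _)

/-- Isometries fixing a point close to `p` map a fixed neighbourhood of `p` into a given one. -/
theorem exists_nhds_mapsTo_of_preservesMetric [RegularSpace M] {p : M} {O : Set M} (hO : O ∈ 𝓝 p) :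
    ∃ W ∈ 𝓝 p, ∀ q ∈ W, ∀ s : M → M, PreservesMetric (n := n) s → ContMDiff (𝓡 n) (𝓡 n) ∞ s →
      s q = q → MapsTo s W O := by
  have : IsManifold (𝓡 n) 1 M := IsManifold.of_le (n := ∞) (by norm_cast)
  have : IsContinuousRiemannianBundle (EuclideanSpace ℝ (Fin n))
      (fun x : M ↦ TangentSpace (𝓡 n) x) := by
    obtain ⟨g, hg, h⟩ := IsContMDiffRiemannianBundle.exists_contMDiff (IB := 𝓡 n) (n := ∞)
      (F := EuclideanSpace ℝ (Fin n)) (E := fun x : M ↦ TangentSpace (𝓡 n) x)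
    exact ⟨g, hg.continuous, h⟩
  obtain ⟨c, hc, hcO⟩ := setOfPred_riemannianEDist_lt_subset_nhds' (𝓡 n) hO
  have hc3 : 0 < c / 3 := ENNReal.div_pos hc.ne' (by simp)
  refine ⟨_, eventually_riemannianEDist_lt (𝓡 n) p hc3, fun q hq s hs hd hsq x hx ↦ hcO ?_⟩
  have hq : riemannianEDist (𝓡 n) p q < c / 3 := hq
  have hx : riemannianEDist (𝓡 n) p x < c / 3 := hx
  change riemannianEDist (𝓡 n) p (s x) < c
  -- Since `s` fixes `q`, the point `s x` is no farther from `q` than `x` is; three distances below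
  -- `c / 3` then suffice.
  calc riemannianEDist (𝓡 n) p (s x)
      ≤ riemannianEDist (𝓡 n) p q + riemannianEDist (𝓡 n) q (s x) := riemannianEDist_triangle
    _ ≤ riemannianEDist (𝓡 n) p q + riemannianEDist (𝓡 n) q x := by
        gcongr
        have := hs.riemannianEDist_le hd q x
        rwa [hsq] at this
    _ ≤ riemannianEDist (𝓡 n) p q + (riemannianEDist (𝓡 n) q p + riemannianEDist (𝓡 n) p x) := by
        gcongr
        exact riemannianEDist_triangle
    _ < c / 3 + (c / 3 + c / 3) := by
        rw [riemannianEDist_comm (x := q)]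
        exact ENNReal.add_lt_add hq (ENNReal.add_lt_add hq hx)
    _ = c := by rw [← add_assoc, ENNReal.add_thirds]

theorem coordMetric_chartDeriv {p x : M}
    (hx : x ∈ (chartAt (EuclideanSpace ℝ (Fin n)) p).source) (v w : TangentSpace (𝓡 n) x) :
    coordMetric p (chartAt (EuclideanSpace ℝ (Fin n)) p x) (chartDeriv p x v) (chartDeriv p x w)
      = inner ℝ v w := by
  obtain ⟨y, hy, rfl⟩ : ∃ y ∈ (chartAt (EuclideanSpace ℝ (Fin n)) p).target,
    (chartAt (EuclideanSpace ℝ (Fin n)) p).symm y = x :=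
    ⟨_, (chartAt (EuclideanSpace ℝ (Fin n)) p).map_source hx,
      (chartAt (EuclideanSpace ℝ (Fin n)) p).left_inv hx⟩
  rw [(chartAt (EuclideanSpace ℝ (Fin n)) p).right_inv hy, coordMetric_apply,
    chartSymmDeriv_chartDeriv hy, chartSymmDeriv_chartDeriv hy]

theorem fderiv_chart_comp_comp_symm {p : M} {s : M → M} (hd : ContMDiff (𝓡 n) (𝓡 n) ∞ s)
    {y : EuclideanSpace ℝ (Fin n)} (hy : y ∈ (chartAt (EuclideanSpace ℝ (Fin n)) p).target)
    (hs : s ((chartAt (EuclideanSpace ℝ (Fin n)) p).symm y) ∈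
      (chartAt (EuclideanSpace ℝ (Fin n)) p).source) (a : EuclideanSpace ℝ (Fin n)) :
    ContDiffAt ℝ ∞ (chartAt (EuclideanSpace ℝ (Fin n)) p ∘ s ∘
        (chartAt (EuclideanSpace ℝ (Fin n)) p).symm) y ∧
      fderiv ℝ (chartAt (EuclideanSpace ℝ (Fin n)) p ∘ s ∘
        (chartAt (EuclideanSpace ℝ (Fin n)) p).symm) y a
      = chartDeriv p (s ((chartAt (EuclideanSpace ℝ (Fin n)) p).symm y))
        (mfderiv (𝓡 n) (𝓡 n) s ((chartAt (EuclideanSpace ℝ (Fin n)) p).symm y)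
          (chartSymmDeriv p y a)) := by
  have h1 : ContMDiffAt (𝓡 n) (𝓡 n) ∞ (chartAt (EuclideanSpace ℝ (Fin n)) p).symm y :=
    contMDiffOn_chart_symm.contMDiffAt
      ((chartAt (EuclideanSpace ℝ (Fin n)) p).open_target.mem_nhds hy)
  have h2 := hd ((chartAt (EuclideanSpace ℝ (Fin n)) p).symm y)
  have h3 : ContMDiffAt (𝓡 n) (𝓡 n) ∞ (chartAt (EuclideanSpace ℝ (Fin n)) p)
      (s ((chartAt (EuclideanSpace ℝ (Fin n)) p).symm y)) :=
    contMDiffOn_chart.contMDiffAt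
      ((chartAt (EuclideanSpace ℝ (Fin n)) p).open_source.mem_nhds hs)
  have h21 := h2.comp y h1
  refine ⟨(h3.comp y h21).contDiffAt, ?_⟩
  rw [← mfderiv_eq_fderiv]
  have e1 := mfderiv_comp_apply y (h3.mdifferentiableAt (by simp))
    (h21.mdifferentiableAt (by simp)) a
  have e2 := mfderiv_comp_apply y (h2.mdifferentiableAt (by simp))
    (h1.mdifferentiableAt (by simp)) a
  refine Eq.trans e1 ?_
  rw [e2]
  rfl

/-- In a Riemannian symmetric space every tangent vector is the value of a local Killing field. -/
theorem IsSymmetricSpace.exists_isKillingOn [T2Space M] (hM : IsSymmetricSpace n M) (p : M)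
    (w : TangentSpace (𝓡 n) p) :
    ∃ (U : Set M) (K : VField n M), p ∈ U ∧ IsKillingOn K U ∧ K p = w := by
  have : LocallyCompactSpace M := ChartedSpace.locallyCompactSpace (EuclideanSpace ℝ (Fin n)) M
  set ψ := chartAt (EuclideanSpace ℝ (Fin n)) p with hψ
  have hp : p ∈ ψ.source := mem_chart_source _ p
  have hp' : ψ p ∈ ψ.target := ψ.map_source hp
  obtain ⟨R, hR, hRt⟩ := nhds_basis_closedBall.mem_iff.1 (ψ.open_target.mem_nhds hp')
  have hO : ψ.source ∩ ψ ⁻¹' closedBall (ψ p) R ∈ 𝓝 p :=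
    inter_mem (ψ.open_source.mem_nhds hp)
      ((ψ.continuousAt hp).preimage_mem_nhds (closedBall_mem_nhds _ hR))
  obtain ⟨W, hW, hWs⟩ := exists_nhds_mapsTo_of_preservesMetric (n := n) hO
  have hW' : ψ.symm ⁻¹' W ∈ 𝓝 (ψ p) := by
    refine (ψ.continuousAt_symm hp').preimage_mem_nhds ?_
    rwa [ψ.left_inv hp]
  obtain ⟨r₀, hr₀, hr₀W⟩ := Metric.mem_nhds_iff.1 hW'
  set r := min r₀ R with hrdef
  have hr : 0 < r := lt_min hr₀ hR
  have hrW : ∀ y ∈ ball (ψ p) r, ψ.symm y ∈ W := fun y hy ↦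
    hr₀W (ball_subset_ball (min_le_left _ _) hy)
  have hrt : ball (ψ p) r ⊆ ψ.target :=
    (ball_subset_closedBall.trans (closedBall_subset_closedBall (min_le_right _ _))).trans hRt
  choose s hs hsx hds using hM
  have hmaps : ∀ q ∈ ball (ψ p) r, ∀ y ∈ ball (ψ p) r,
      s (ψ.symm q) (ψ.symm y) ∈ ψ.source ∩ ψ ⁻¹' closedBall (ψ p) R := fun q hq y hy ↦
    hWs _ (hrW q hq) (s (ψ.symm q)) (hs _) (s (ψ.symm q)).contMDiff (hsx _) (hrW y hy)
  obtain ⟨ρ, hρ, hρt, u, hu, hup, hK⟩ := (isMetricOn_coordMetric p).exists_killing hr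
    (min_le_right _ _) hRt (σ := fun q ↦ ψ ∘ s (ψ.symm q) ∘ ψ.symm) (fun q hq ↦ by
      have hF := fun y (hy : y ∈ ball (ψ p) r) a ↦ fderiv_chart_comp_comp_symm (p := p)
        (s (ψ.symm q)).contMDiff (hrt hy) (hmaps q hq y hy).1 a
      refine ⟨⟨isOpen_ball, fun y hy ↦ ((hF y hy 0).1).contDiffWithinAt,
        fun y hy ↦ (hmaps q hq y hy).2, fun y hy v w ↦ ?_⟩, ?_, ?_⟩
      · rw [(hF y hy v).2, (hF y hy w).2]
        refine (coordMetric_chartDeriv (hmaps q hq y hy).1 _ _).trans ?_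
        rw [hs, coordMetric_apply]
      · simp only [Function.comp_apply]
        rw [hsx, ψ.right_inv (hrt hq)]
      · ext1 a
        rw [(hF q hq a).2]
        have h1 := hds (ψ.symm q) (chartSymmDeriv p q a)
        -- The differential of the symmetry lands in the tangent space at the image of the centre,
        -- equal to the centre only propositionally; this moves the base point while keeping the
        -- vector in `ℝⁿ`.
        have h2 : ∀ (z z' : M) (_ : z = z') (v : EuclideanSpace ℝ (Fin n)),
          (chartDeriv p z : EuclideanSpace ℝ (Fin n) →L[ℝ] EuclideanSpace ℝ (Fin n)) v
            = (chartDeriv p z' : EuclideanSpace ℝ (Fin n) →L[ℝ] EuclideanSpace ℝ (Fin n)) v := by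
          rintro z _ rfl v; rfl
        refine (h2 _ _ (hsx (ψ.symm q)) _).trans ?_
        refine (congrArg (chartDeriv p (ψ.symm q)) h1).trans ?_
        refine (map_neg _ _).trans ?_
        rw [chartDeriv_chartSymmDeriv (hrt hq)]
        rfl) (chartDeriv p p w)
  refine ⟨ψ.source ∩ ψ ⁻¹' ball (ψ p) ρ, fieldOfCoord p u, ⟨hp, ?_⟩,
    isKillingOn_fieldOfCoord isOpen_ball hu hK, ?_⟩
  · exact mem_ball_self hρ
  · apply (isInvertible_chartDeriv hp).injective
    refine ((isInvertible_chartDeriv hp).self_apply_inverse _).trans ?_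
    exact hup

end KillingFields

/-! ### Smooth frames, cut-offs and global extension of local fields -/

section Frames

open Filter Topology

variable {n : ℕ} {M : Type*} [TopologicalSpace M] [ChartedSpace (EuclideanSpace ℝ (Fin n)) M]
  [IsManifold (𝓡 n) ∞ M]

theorem coordRep_chart {p x : M} (hx : x ∈ (chartAt (EuclideanSpace ℝ (Fin n)) p).source)
    (X : VField n M) :
    coordRep p X (chartAt (EuclideanSpace ℝ (Fin n)) p x) = chartDeriv p x (X x) := by
  obtain ⟨y, hy, rfl⟩ : ∃ y ∈ (chartAt (EuclideanSpace ℝ (Fin n)) p).target,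
    (chartAt (EuclideanSpace ℝ (Fin n)) p).symm y = x :=
    ⟨_, (chartAt (EuclideanSpace ℝ (Fin n)) p).map_source hx,
      (chartAt (EuclideanSpace ℝ (Fin n)) p).left_inv hx⟩
  rw [(chartAt (EuclideanSpace ℝ (Fin n)) p).right_inv hy, ← chartSymmDeriv_coordRep hy X,
    chartDeriv_chartSymmDeriv hy]

theorem contDiffAt_coordRep_chart {p x : M}
    (hx : x ∈ (chartAt (EuclideanSpace ℝ (Fin n)) p).source) {X : VField n M}
    (hX : ContMDiffAt (𝓡 n) (𝓡 n).tangent ∞ (fun x ↦ (⟨x, X x⟩ : TangentBundle (𝓡 n) M)) x) :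
    ContDiffAt ℝ ∞ (coordRep p X) (chartAt (EuclideanSpace ℝ (Fin n)) p x) :=
  contDiffAt_coordRep ((chartAt (EuclideanSpace ℝ (Fin n)) p).map_source hx)
    (by rwa [(chartAt (EuclideanSpace ℝ (Fin n)) p).left_inv hx])

theorem contMDiffAt_comp_chart {p x : M} {F : Type*} [NormedAddCommGroup F] [NormedSpace ℝ F]
    (hx : x ∈ (chartAt (EuclideanSpace ℝ (Fin n)) p).source)
    {f : EuclideanSpace ℝ (Fin n) → F}
    (hf : ContDiffAt ℝ ∞ f (chartAt (EuclideanSpace ℝ (Fin n)) p x)) :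
    ContMDiffAt (𝓡 n) 𝓘(ℝ, F) ∞ (fun x ↦ f (chartAt (EuclideanSpace ℝ (Fin n)) p x)) x := by
  have h : ContMDiffAt (𝓡 n) (𝓡 n) ∞ (chartAt (EuclideanSpace ℝ (Fin n)) p) x :=
    contMDiffOn_chart.contMDiffAt
      ((chartAt (EuclideanSpace ℝ (Fin n)) p).open_source.mem_nhds hx)
  exact hf.contMDiffAt.comp x h

/-- Vector fields which form a basis of the tangent space at `p` form a smooth frame near `p`. -/
theorem exists_smooth_coefficients (p : M) (K : Fin n → VField n M) {U : Set M} (hU : IsOpen U)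
    (hpU : p ∈ U) (hK : ∀ j, SmoothOn (K j) U)
    (hKp : ∀ j, chartDeriv p p (K j p) = EuclideanSpace.single j (1 : ℝ)) :
    ∃ V : Set M, IsOpen V ∧ p ∈ V ∧ V ⊆ U ∧ ∀ X : VField n M, SmoothOn X V →
      ∃ c : Fin n → M → ℝ, (∀ j, ContMDiffOn (𝓡 n) 𝓘(ℝ, ℝ) ∞ (c j) V) ∧
        ∀ x ∈ V, X x = ∑ j, c j x • K j x := by
  set ψ := chartAt (EuclideanSpace ℝ (Fin n)) p with hψ
  have hp : p ∈ ψ.source := mem_chart_source _ p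
  -- The matrix whose columns are the fields in coordinates. It is the identity at `p`, hence
  -- invertible nearby, and the coefficients of `X` are its smooth inverse applied to the
  -- coordinates of `X`.
  let A : EuclideanSpace ℝ (Fin n) → EuclideanSpace ℝ (Fin n) →L[ℝ] EuclideanSpace ℝ (Fin n) :=
    fun y ↦ ∑ j, (EuclideanSpace.proj j : EuclideanSpace ℝ (Fin n) →L[ℝ] ℝ).smulRight
      (coordRep p (K j) y)
  have hAapp : ∀ y a, A y a = ∑ j, a j • coordRep p (K j) y := fun y a ↦ by
    simp [A]
  have hA : ∀ x ∈ ψ.source ∩ U, ContDiffAt ℝ ∞ A (ψ x) := fun x hx ↦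
    ContDiffAt.sum fun j _ ↦ contDiffAt_const.smulRight
      (contDiffAt_coordRep_chart hx.1 ((hK j).contMDiffAt (hU.mem_nhds hx.2)))
  have hA1 : A (ψ p) = 1 := by
    ext1 a
    rw [hAapp]
    simp only [hψ, coordRep_chart hp, hKp]
    ext i
    simp [Pi.single_apply]
  have hAc : ContinuousOn (fun x ↦ A (ψ x)) (ψ.source ∩ U) := fun x hx ↦
    ((hA x hx).continuousAt.comp (ψ.continuousAt hx.1)).continuousWithinAt
  refine ⟨(ψ.source ∩ U) ∩ (fun x ↦ A (ψ x)) ⁻¹' {a | IsUnit a},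
    hAc.isOpen_inter_preimage (ψ.open_source.inter hU) Units.isOpen, ⟨⟨hp, hpU⟩, ?_⟩,
    fun x hx ↦ hx.1.2, fun X hX ↦ ⟨fun j x ↦ Ring.inverse (A (ψ x)) (coordRep p X (ψ x)) j, ?_, ?_⟩⟩
  · change IsUnit (A (ψ p))
    rw [hA1]
    exact isUnit_one
  · intro j x hx
    have hXx := contDiffAt_coordRep_chart hx.1.1 (hX.contMDiffAt
      ((hAc.isOpen_inter_preimage (ψ.open_source.inter hU) Units.isOpen).mem_nhds hx))
    obtain ⟨u, hu⟩ : IsUnit (A (ψ x)) := hx.2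
    have hinv : ContDiffAt ℝ ∞ (Ring.inverse : _ → EuclideanSpace ℝ (Fin n) →L[ℝ]
      EuclideanSpace ℝ (Fin n)) (A (ψ x)) := hu ▸ contDiffAt_ringInverse ℝ u
    have h1 : ContDiffAt ℝ ∞ (fun y ↦ Ring.inverse (A y) (coordRep p X y)) (ψ x) :=
      (hinv.comp (ψ x) (hA x hx.1)).clm_apply hXx
    have h2 : ContDiffAt ℝ ∞ (fun y ↦ (EuclideanSpace.proj j : EuclideanSpace ℝ (Fin n) →L[ℝ] ℝ)
      (Ring.inverse (A y) (coordRep p X y))) (ψ x) :=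
      (EuclideanSpace.proj j : EuclideanSpace ℝ (Fin n) →L[ℝ] ℝ).contDiff.contDiffAt.comp _ h1
    exact (contMDiffAt_comp_chart hx.1.1 h2).contMDiffWithinAt
  · intro x hx
    apply (isInvertible_chartDeriv hx.1.1).injective
    change chartDeriv p x (X x) = chartDeriv p x _
    rw [map_sum]
    simp only [map_smul, ← coordRep_chart hx.1.1]
    rw [← hAapp, ← mul_apply_eq_comp, Ring.mul_inverse_cancel _ hx.2]
    rfl

variable [T2Space M] [SecondCountableTopology M]

theorem exists_smooth_cutoff {C U : Set M} (hC : IsClosed C) (hU : IsOpen U) (h : C ⊆ U) :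
    ∃ χ : M → ℝ, ContMDiff (𝓡 n) 𝓘(ℝ, ℝ) ∞ χ ∧ tsupport χ ⊆ U ∧ ∀ᶠ x in 𝓝ˢ C, χ x = 1 := by
  have : LocallyCompactSpace M := ChartedSpace.locallyCompactSpace (EuclideanSpace ℝ (Fin n)) M
  obtain ⟨V, hV, hCV, hVU⟩ := normal_exists_closure_subset hC hU h
  obtain ⟨f, h1, h0, -⟩ := exists_contMDiffMap_one_nhds_of_subset_interior (𝓡 n) (n := ⊤) hC
    (hCV.trans (hV.subset_interior_iff.2 subset_closure))
  refine ⟨f, f.contMDiff, (closure_minimal (fun x hx ↦ ?_) isClosed_closure).trans hVU, h1⟩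
  by_contra hxV
  exact hx (h0 x hxV)

/-- Regularity of `S` is stated with globally smooth fields; cutting off lets it be applied to local
ones, such as Killing fields. -/
theorem SmoothOn.exists_eventuallyEq {X : VField n M} {C U : Set M} (hX : SmoothOn X U)
    (hC : IsClosed C) (hU : IsOpen U) (h : C ⊆ U) :
    ∃ Y : VField n M, SmoothOn Y Set.univ ∧ ∀ᶠ x in 𝓝ˢ C, Y x = X x := by
  obtain ⟨χ, hχ, hs, h1⟩ := exists_smooth_cutoff (n := n) hC hU h
  refine ⟨χ • X,
    ContMDiff.contMDiffOn (ContMDiffOn.smul_section_of_tsupport hχ.contMDiffOn hU hs hX),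
    h1.mono fun x hx ↦ ?_⟩
  change χ x • X x = X x
  rw [hx, one_smul]

theorem SmoothOn.exists_eventuallyEq_nhds {X : VField n M} {U : Set M} {x : M} (hX : SmoothOn X U)
    (hU : U ∈ 𝓝 x) : ∃ Y : VField n M, SmoothOn Y Set.univ ∧ Y =ᶠ[𝓝 x] X := by
  obtain ⟨V, hVU, hV, hx⟩ := mem_nhds_iff.1 hU
  obtain ⟨Y, hY, h⟩ := SmoothOn.exists_eventuallyEq (hX.mono hVU) (isClosed_singleton (x := x)) hV
    (Set.singleton_subset_iff.2 hx)
  exact ⟨Y, hY, by rwa [nhdsSet_singleton] at h⟩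

theorem exists_smoothOn_ext {x : M} (v : TangentSpace (𝓡 n) x) :
    ∃ U ∈ 𝓝 x, SmoothOn (ext v) U :=
  FiberBundle.exists_contMDiffOn_extend (𝓡 n) (EuclideanSpace ℝ (Fin n)) v

theorem IsC1.mdifferentiableAt {S : TwoTensor n M} (hS : IsC1 S) {X Y : VField n M} {U V : Set M}
    {x : M} (hU : U ∈ 𝓝 x) (hV : V ∈ 𝓝 x) (hX : SmoothOn X U) (hY : SmoothOn Y V) :
    MDifferentiableAt (𝓡 n) 𝓘(ℝ) (fun y ↦ S y (X y) (Y y)) x := by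
  obtain ⟨X', hX', h1⟩ := hX.exists_eventuallyEq_nhds hU
  obtain ⟨Y', hY', h2⟩ := hY.exists_eventuallyEq_nhds hV
  refine ((hS X' Y' hX' hY' x).mdifferentiableAt (by simp)).congr_of_eventuallyEq ?_
  filter_upwards [h1, h2] with y hy1 hy2
  rw [hy1, hy2]

end Frames

/-! ### Contraction of `S` with the derivative of a field -/

section Pointwise

open Filter Topology

variable {n : ℕ} {M : Type*} [TopologicalSpace M] [ChartedSpace (EuclideanSpace ℝ (Fin n)) M]
  [IsManifold (𝓡 n) ∞ M] [RiemannianBundle (fun x : M ↦ TangentSpace (𝓡 n) x)]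

/-- The full contraction of a symmetric bilinear form with a skew endomorphism vanishes. -/
theorem sum_apply_skew_eq_zero {x : M}
    (B : TangentSpace (𝓡 n) x →L[ℝ] TangentSpace (𝓡 n) x →L[ℝ] ℝ) (hB : ∀ v w, B v w = B w v)
    (A : TangentSpace (𝓡 n) x → TangentSpace (𝓡 n) x)
    (hA : ∀ v w, inner ℝ (A v) w + inner ℝ v (A w) = 0) :
    ∑ i, B (onb x i) (A (onb x i)) = 0 := by
  have h1 : ∑ i, B (onb x i) (A (onb x i))
      = ∑ i, ∑ j, inner ℝ (onb x j) (A (onb x i)) * B (onb x i) (onb x j) :=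
    Finset.sum_congr rfl fun i _ ↦ by
      conv_lhs => rw [← (onb x).sum_repr' (A (onb x i))]
      rw [map_sum]
      exact Finset.sum_congr rfl fun j _ ↦ map_smul _ _ _
  -- Exchanging the two indices fixes `B` and changes the sign of the matrix of `A`, so the sum
  -- equals its own negative.
  have h2 : ∑ i, ∑ j, inner ℝ (onb x j) (A (onb x i)) * B (onb x i) (onb x j)
      = - ∑ i, ∑ j, inner ℝ (onb x j) (A (onb x i)) * B (onb x i) (onb x j) := by
    rw [← Finset.sum_neg_distrib]
    conv_lhs => rw [Finset.sum_comm]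
    refine Finset.sum_congr rfl fun j _ ↦ ?_
    rw [← Finset.sum_neg_distrib]
    refine Finset.sum_congr rfl fun i _ ↦ ?_
    have := hA (onb x i) (onb x j)
    rw [hB (onb x i), ← neg_mul]
    congr 1
    rw [real_inner_comm] at this
    linarith
  rw [h1]
  linarith

/-- The function `∑ᵢ S(eᵢ, ∇_{eᵢ} X)`. -/
def pairing (S : TwoTensor n M) (X : VField n M) (x : M) : ℝ :=
  ∑ i, S x (onb x i) (leviCivita X (onb x i))

/-- The gradient of a function. -/
def grad (φ : M → ℝ) : VField n M := fun x ↦ ∑ i, mvfderiv (𝓡 n) φ x (onb x i) • onb x i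

theorem apply_grad (S : TwoTensor n M) (X : VField n M) (φ : M → ℝ) (x : M) :
    S x (X x) (grad φ x) = ∑ i, contract S X x (onb x i) * mvfderiv (𝓡 n) φ x (onb x i) := by
  rw [grad, map_sum]
  refine Finset.sum_congr rfl fun i _ ↦ ?_
  rw [map_smul, smul_eq_mul, mul_comm]
  rfl

theorem inner_grad (φ : M → ℝ) (x : M) (v : TangentSpace (𝓡 n) x) :
    inner ℝ (grad φ x) v = mvfderiv (𝓡 n) φ x v := by
  conv_rhs => rw [← (onb x).sum_repr' v]
  rw [grad, sum_inner, map_sum]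
  refine Finset.sum_congr rfl fun i _ ↦ ?_
  rw [real_inner_smul_left, map_smul, smul_eq_mul, mul_comm]

variable [IsContMDiffRiemannianBundle (𝓡 n) ∞ (EuclideanSpace ℝ (Fin n))
      (fun x : M ↦ TangentSpace (𝓡 n) x)]

theorem grad_eq_zero {φ : M → ℝ} {x : M} (hx : x ∉ tsupport φ) :
    grad φ x = (0 : TangentSpace (𝓡 n) x) := by
  have h : φ =ᶠ[𝓝 x] fun _ ↦ 0 := notMem_tsupport_iff_eventuallyEq.1 hx
  refine Finset.sum_eq_zero fun i _ ↦ ?_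
  rw [mvfderiv_congr h, mvfderiv_const]
  simp

theorem pairing_eq_zero (S : TwoTensor n M) {X : VField n M} {x : M}
    (h : X =ᶠ[𝓝 x] (0 : VField n M)) :
    pairing S X x = 0 :=
  Finset.sum_eq_zero fun i _ ↦ by rw [leviCivita_congr h, leviCivita_zero, map_zero]

theorem pairing_sum (S : TwoTensor n M) {ι : Type*} (s : Finset ι) (Y : ι → VField n M) {x : M}
    (hY : ∀ i ∈ s, DiffAt (Y i) x) :
    pairing S (∑ i ∈ s, Y i) x = ∑ i ∈ s, pairing S (Y i) x := by
  simp only [pairing]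
  rw [Finset.sum_comm]
  refine Finset.sum_congr rfl fun i _ ↦ ?_
  rw [(leviCivita_sum s Y hY _).2, map_sum]

theorem pairing_eq_zero_of_isKillingOn {S : TwoTensor n M} (hS : IsSymm S) {K : VField n M}
    {U : Set M} (hK : IsKillingOn K U) {x : M} (hx : x ∈ U) : pairing S K x = 0 :=
  sum_apply_skew_eq_zero (S x) (hS x) (fun v ↦ leviCivita K v) (hK.skew x hx)

/-- Leibniz splits the contraction into `S(K, grad φ)` and `φ` times the contraction for `K`, which
vanishes where `K` is Killing. Off the support of `φ` both sides are zero, so the identity is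
global. -/
theorem pairing_smul_of_isKillingOn {S : TwoTensor n M} (hS : IsSymm S) {K : VField n M}
    {U : Set M} (hK : IsKillingOn K U) {φ : M → ℝ} (hφ : ContMDiff (𝓡 n) 𝓘(ℝ, ℝ) ∞ φ)
    (hφU : tsupport φ ⊆ U) (x : M) : pairing S (φ • K) x = S x (K x) (grad φ x) := by
  by_cases hx : x ∈ tsupport φ
  · have h0 := pairing_eq_zero_of_isKillingOn hS hK (hφU hx)
    have h1 : ∀ i, S x (onb x i) (leviCivita (φ • K) (onb x i))
        = contract S K x (onb x i) * mvfderiv (𝓡 n) φ x (onb x i)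
          + φ x * S x (onb x i) (leviCivita K (onb x i)) := fun i ↦ by
      rw [leviCivita_smul ((hφ x).mdifferentiableAt (by simp))
        (hK.smooth.diffAt (hK.isOpen.mem_nhds (hφU hx))), map_add, map_smul, map_smul,
        hS x (onb x i) (K x), smul_eq_mul, smul_eq_mul, mul_comm (mvfderiv _ _ _ _)]
      rfl
    rw [apply_grad, pairing, Finset.sum_congr rfl fun i _ ↦ h1 i, Finset.sum_add_distrib,
      ← Finset.mul_sum]
    change _ + φ x * pairing S K x = _
    rw [h0, mul_zero, add_zero]
  · rw [grad_eq_zero hx, map_zero]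
    refine pairing_eq_zero S ((notMem_tsupport_iff_eventuallyEq.1 hx).mono fun y hy ↦ ?_)
    change φ y • K y = 0
    rw [hy]
    exact zero_smul _ _

/-- The pointwise bases `onb x` need not vary smoothly, so the gradient is identified in a chart
with the inverse metric applied to `dφ`. -/
theorem smoothOn_grad {φ : M → ℝ} (hφ : ContMDiff (𝓡 n) 𝓘(ℝ, ℝ) ∞ φ) :
    SmoothOn (grad φ : VField n M) Set.univ := by
  intro p _
  set ψ := chartAt (EuclideanSpace ℝ (Fin n)) p with hψ
  have hp : p ∈ ψ.source := mem_chart_source _ p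
  have hG := isMetricOn_coordMetric (n := n) p
  have hp' : ψ p ∈ ψ.target := ψ.map_source hp
  have h1 : ContMDiffAt (𝓡 n) (𝓡 n) ∞ ψ.symm (ψ p) :=
    contMDiffOn_chart_symm.contMDiffAt (ψ.open_target.mem_nhds hp')
  have h2 : ContDiffAt ℝ ∞ (fun z ↦ φ (ψ.symm z)) (ψ p) :=
    ((hφ _).comp (ψ p) h1).contDiffAt
  have h3 : ContDiffAt ℝ ∞ (fun y ↦ (coordMetric p y).inverse (fderiv ℝ (fun z ↦ φ (ψ.symm z)) y))
      (ψ p) :=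
    (((hG.isInvertible hp').contDiffAt_map_inverse).comp (ψ p)
      (hG.smooth.contDiffAt (ψ.open_target.mem_nhds hp'))).clm_apply (h2.fderiv_right (by simp))
  refine ((contMDiffAt_fieldOfCoord hp h3).congr_of_eventuallyEq ?_).contMDiffWithinAt
  filter_upwards [ψ.open_source.mem_nhds hp] with x hx
  congr 1
  obtain ⟨y, hy, rfl⟩ : ∃ y ∈ ψ.target, ψ.symm y = x := ⟨_, ψ.map_source hx, ψ.left_inv hx⟩
  refine ext_inner_right ℝ fun v ↦ ?_
  rw [inner_grad, fieldOfCoord_symm hy, ← chartSymmDeriv_chartDeriv hy v, ← coordMetric_apply,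
    hG.inverse_apply hy, mvfderiv_eq_fderiv_comp_symm hy ((hφ _).mdifferentiableAt (by simp))]

end Pointwise

/-! ### Test fields `φ K` and integrability -/

section Distributions

open Filter Topology

variable {n : ℕ} {M : Type*} [TopologicalSpace M] [ChartedSpace (EuclideanSpace ℝ (Fin n)) M]
  [IsManifold (𝓡 n) ∞ M] [RiemannianBundle (fun x : M ↦ TangentSpace (𝓡 n) x)]
  [IsContMDiffRiemannianBundle (𝓡 n) ∞ (EuclideanSpace ℝ (Fin n))
      (fun x : M ↦ TangentSpace (𝓡 n) x)]
  [MeasurableSpace M] [BorelSpace M]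

theorem WeakDivFree.weakCoclosedOn {S : TwoTensor n M} (hS : IsSymm S) (h : WeakDivFree S)
    {K : VField n M} {U : Set M} (hK : IsKillingOn K U) : WeakCoclosedOn (contract S K) U := by
  intro φ hφ hc hs
  have := h (φ • K)
    (ContMDiff.contMDiffOn (ContMDiffOn.smul_section_of_tsupport hφ.contMDiffOn hK.isOpen hs
      hK.smooth)) ⟨tsupport φ, hc, fun x hx ↦ by
        change φ x • K x = 0
        rw [image_eq_zero_of_notMem_tsupport hx, zero_smul]⟩
  rw [← this]
  congr 1
  funext x
  rw [← apply_grad]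
  exact (pairing_smul_of_isKillingOn hS hK hφ hs x).symm

variable [T2Space M] [SecondCountableTopology M]

/-- Cutting `K` off near the support of `φ` makes this a component of `S` along global smooth
fields, and compact support turns local integrability into integrability. This permits splitting the
integral of a finite sum. -/
theorem IsL1Loc.integrable_apply_grad {S : TwoTensor n M} (hS : IsL1Loc S) {K : VField n M}
    {U : Set M} (hU : IsOpen U) (hK : SmoothOn K U) {φ : M → ℝ}
    (hφ : ContMDiff (𝓡 n) 𝓘(ℝ, ℝ) ∞ φ) (hc : HasCompactSupport φ) (hs : tsupport φ ⊆ U) :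
    Integrable (fun x ↦ S x (K x) (grad φ x)) (riemannianVolume n M) := by
  obtain ⟨Y, hY, hYK⟩ := hK.exists_eventuallyEq (isClosed_tsupport φ) hU hs
  have h := (hS Y (grad φ) hY (smoothOn_grad hφ)).integrableOn_isCompact hc
  have h2 : (fun x ↦ S x (K x) (grad φ x)) = fun x ↦ S x (Y x) (grad φ x) := by
    funext x
    by_cases hx : x ∈ tsupport φ
    · rw [hYK.self_of_nhdsSet x hx]
    · rw [grad_eq_zero hx, map_zero, map_zero]
  rw [h2]
  refine (integrableOn_iff_integrable_of_support_subset fun x hx ↦ ?_).1 h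
  by_contra hx'
  exact hx (by simp only [grad_eq_zero hx', map_zero])

end Distributions

/-! ### Compactly supported fields as sums of multiples of Killing fields -/

section Decomposition

open Filter Topology

variable {n : ℕ} {M : Type*} [TopologicalSpace M] [ChartedSpace (EuclideanSpace ℝ (Fin n)) M]
  [IsManifold (𝓡 n) ∞ M] [RiemannianBundle (fun x : M ↦ TangentSpace (𝓡 n) x)]
  [IsContMDiffRiemannianBundle (𝓡 n) ∞ (EuclideanSpace ℝ (Fin n))
      (fun x : M ↦ TangentSpace (𝓡 n) x)]

theorem IsKillingOn.mono {K : VField n M} {U V : Set M} (hK : IsKillingOn K U) (hV : IsOpen V)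
    (h : V ⊆ U) : IsKillingOn K V :=
  ⟨hV, ContMDiffOn.mono hK.smooth h, fun x hx ↦ hK.skew x (h hx)⟩

variable [T2Space M] [SecondCountableTopology M]

/-- Near every point of a symmetric space, vector fields are combinations of local Killing fields
with smooth coefficients. -/
theorem IsSymmetricSpace.exists_killing_frame (hM : IsSymmetricSpace n M) (p : M) :
    ∃ (U : Set M) (K : Fin n → VField n M), p ∈ U ∧ IsOpen U ∧ (∃ C, IsCompact C ∧ U ⊆ C) ∧
      (∀ j, IsKillingOn (K j) U) ∧ ∀ X : VField n M, SmoothOn X Set.univ →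
      ∃ c : Fin n → M → ℝ, (∀ j, ContMDiffOn (𝓡 n) 𝓘(ℝ, ℝ) ∞ (c j) U) ∧
        ∀ x ∈ U, X x = ∑ j, c j x • K j x := by
  have : LocallyCompactSpace M := ChartedSpace.locallyCompactSpace (EuclideanSpace ℝ (Fin n)) M
  obtain ⟨C, hC, hpC⟩ := exists_compact_mem_nhds p
  have hp := mem_chart_source (EuclideanSpace ℝ (Fin n)) p
  choose U K hpU hK hKp using fun j : Fin n ↦ hM.exists_isKillingOn p
    ((mfderiv (𝓡 n) (𝓡 n) (chartAt (EuclideanSpace ℝ (Fin n)) p) p).inverse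
      (EuclideanSpace.single j (1 : ℝ)))
  have hO : IsOpen (⋂ j, U j) := isOpen_iInter_of_finite fun j ↦ (hK j).isOpen
  obtain ⟨V, hV, hpV, hVU, h⟩ := exists_smooth_coefficients p K (hO.inter isOpen_interior)
    -- Staying inside the compact set `C` later gives the coefficient functions compact support.
    ⟨Set.mem_iInter.2 hpU, mem_interior_iff_mem_nhds.2 hpC⟩
    (fun j ↦ (hK j).smooth.mono fun x hx ↦ Set.mem_iInter.1 hx.1 j)
    (fun j ↦ by
      rw [hKp]
      exact (isInvertible_chartDeriv hp).self_apply_inverse _)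
  exact ⟨V, K, hpV, hV, ⟨C, hC, fun x hx ↦ interior_subset (hVU hx).2⟩,
    fun j ↦ (hK j).mono hV fun x hx ↦ Set.mem_iInter.1 (hVU hx).1 j,
    fun X hX ↦ h X (hX.mono (Set.subset_univ _))⟩

/-- In a symmetric space, compactly supported vector fields are finite sums of multiples of local
Killing fields. -/
theorem IsSymmetricSpace.exists_eq_sum_smul (hM : IsSymmetricSpace n M) {X : VField n M}
    (hX : SmoothOn X Set.univ) {C : Set M} (hC : IsCompact C) (hXC : ∀ x ∉ C, X x = 0) :
    ∃ (s : Finset (M × Fin n)) (U : M × Fin n → Set M) (K : M × Fin n → VField n M)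
      (φ : M × Fin n → M → ℝ), (∀ i, IsKillingOn (K i) (U i)) ∧
      (∀ i, ContMDiff (𝓡 n) 𝓘(ℝ, ℝ) ∞ (φ i)) ∧ (∀ i, HasCompactSupport (φ i)) ∧
      (∀ i, tsupport (φ i) ⊆ U i) ∧ X = ∑ i ∈ s, φ i • K i := by
  have : LocallyCompactSpace M := ChartedSpace.locallyCompactSpace (EuclideanSpace ℝ (Fin n)) M
  choose U K hpU hU hUc hK hc using fun p ↦ hM.exists_killing_frame p
  choose c hcs hcX using fun p ↦ hc p X hX
  obtain ⟨f, hf⟩ := SmoothPartitionOfUnity.exists_isSubordinate (𝓡 n) hC.isClosed U hU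
    fun x _ ↦ Set.mem_iUnion.2 ⟨x, hpU x⟩
  have hfin := f.locallyFinite.finite_nonempty_inter_compact hC
  have hts : ∀ i : M × Fin n, tsupport (fun x ↦ f i.1 x * c i.1 i.2 x) ⊆ tsupport (f i.1) :=
    fun i ↦ tsupport_mul_subset_left
  refine ⟨hfin.toFinset ×ˢ Finset.univ, fun i ↦ U i.1, fun i ↦ K i.1 i.2,
    fun i x ↦ f i.1 x * c i.1 i.2 x, fun i ↦ hK _ _, fun i ↦ ?_, fun i ↦ ?_, fun i ↦
    (hts i).trans (hf _), ?_⟩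
  · refine contMDiff_of_tsupport fun x hx ↦ ?_
    exact ((f i.1).contMDiff x).mul
      ((hcs i.1 i.2).contMDiffAt ((hU _).mem_nhds (hf _ (hts i hx))))
  · obtain ⟨C', hC', hUC'⟩ := hUc i.1
    exact hC'.of_isClosed_subset (isClosed_tsupport _) (((hts i).trans (hf _)).trans hUC')
  · funext x
    -- Inside `U p` this is the frame expansion of `X`; outside, the factor `f p x` vanishes.
    have h1 : ∀ p, ∑ j, (f p x * c p j x) • K p j x = f p x • X x := fun p ↦ by
      simp only [mul_smul]
      rw [← Finset.smul_sum]
      by_cases hp : x ∈ U p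
      · rw [← hcX p x hp]
      · rw [image_eq_zero_of_notMem_tsupport fun h ↦ hp (hf p h), zero_smul, zero_smul]
    rw [Finset.sum_apply, Finset.sum_product]
    change X x = ∑ p ∈ hfin.toFinset, ∑ j, (f p x * c p j x) • K p j x
    rw [Finset.sum_congr rfl fun p _ ↦ h1 p, ← Finset.sum_smul]
    by_cases hx : x ∈ C
    · rw [SmoothPartitionOfUnity.sum_finsupport' f x hx, one_smul]
      intro p hp
      rw [SmoothPartitionOfUnity.mem_finsupport] at hp
      exact hfin.mem_toFinset.2 ⟨x, hp, hx⟩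
    · rw [hXC x hx, smul_zero]

variable [MeasurableSpace M] [BorelSpace M]

theorem IsSymmetricSpace.weakDivFree (hM : IsSymmetricSpace n M) {S : TwoTensor n M}
    (hS : IsSymm S) (hL : IsL1Loc S)
    (h : ∀ (U : Set M) (K : VField n M), IsKillingOn K U → WeakCoclosedOn (contract S K) U) :
    WeakDivFree S := by
  rintro X hX ⟨C, hC, hXC⟩
  obtain ⟨s, U, K, φ, hK, hφ, hc, hs, rfl⟩ := hM.exists_eq_sum_smul hX hC hXC
  have h1 : ∀ x, pairing S (∑ i ∈ s, φ i • K i) x = ∑ i ∈ s, S x (K i x) (grad (φ i) x) := by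
    intro x
    rw [pairing_sum]
    · exact Finset.sum_congr rfl fun i _ ↦ pairing_smul_of_isKillingOn hS (hK i) (hφ i) (hs i) x
    · intro i _
      exact SmoothOn.diffAt (U := Set.univ) (ContMDiff.contMDiffOn
        (ContMDiffOn.smul_section_of_tsupport (hφ i).contMDiffOn (hK i).isOpen (hs i)
          (hK i).smooth)) univ_mem
  change ∫ x, pairing S (∑ i ∈ s, φ i • K i) x ∂(riemannianVolume n M) = 0
  simp only [h1]
  rw [integral_finsetSum _ fun i _ ↦
    hL.integrable_apply_grad (hK i).isOpen (hK i).smooth (hφ i) (hc i) (hs i)]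
  refine Finset.sum_eq_zero fun i _ ↦ ?_
  simp only [apply_grad]
  exact h (U i) (K i) (hK i) (φ i) (hφ i) (hc i) (hs i)

end Decomposition

/-! ### The pointwise identity for tensors of class `C¹` -/

section Classical

open Filter Topology

variable {n : ℕ} {M : Type*} [TopologicalSpace M] [ChartedSpace (EuclideanSpace ℝ (Fin n)) M]
  [IsManifold (𝓡 n) ∞ M]

theorem eq_sum_coordRep_smul {p x : M}
    (hx : x ∈ (chartAt (EuclideanSpace ℝ (Fin n)) p).source) (X : VField n M) :
    X x = ∑ j : Fin n, coordRep p X (chartAt (EuclideanSpace ℝ (Fin n)) p x) j •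
      fieldOfCoord p (fun _ ↦ EuclideanSpace.single j (1 : ℝ)) x := by
  obtain ⟨y, hy, rfl⟩ : ∃ y ∈ (chartAt (EuclideanSpace ℝ (Fin n)) p).target,
    (chartAt (EuclideanSpace ℝ (Fin n)) p).symm y = x :=
    ⟨_, (chartAt (EuclideanSpace ℝ (Fin n)) p).map_source hx,
      (chartAt (EuclideanSpace ℝ (Fin n)) p).left_inv hx⟩
  rw [(chartAt (EuclideanSpace ℝ (Fin n)) p).right_inv hy, ← chartSymmDeriv_coordRep hy X]
  simp only [fieldOfCoord_symm hy, ← map_smul]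
  rw [← map_sum]
  congr 1
  ext i
  simp [Pi.single_apply]

theorem mvfderiv_finset_sum {ι : Type*} (s : Finset ι) (f : ι → M → ℝ) {x : M}
    (hf : ∀ i ∈ s, MDifferentiableAt (𝓡 n) 𝓘(ℝ) (f i) x) (v : TangentSpace (𝓡 n) x) :
    MDifferentiableAt (𝓡 n) 𝓘(ℝ) (∑ i ∈ s, f i) x ∧
      mvfderiv (𝓡 n) (∑ i ∈ s, f i) x v = ∑ i ∈ s, mvfderiv (𝓡 n) (f i) x v := by
  classical
  induction s using Finset.induction_on with
  | empty =>
    refine ⟨mdifferentiableAt_const (c := (0 : ℝ)), ?_⟩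
    rw [Finset.sum_empty, Finset.sum_empty]
    change mvfderiv (𝓡 n) (fun _ : M ↦ (0 : ℝ)) x v = 0
    rw [mvfderiv_const]
    rfl
  | insert i s hi ih =>
    obtain ⟨h1, h2⟩ := ih fun j hj ↦ hf j (Finset.mem_insert_of_mem hj)
    have h3 := hf i (Finset.mem_insert_self i s)
    rw [Finset.sum_insert hi, Finset.sum_insert hi, mvfderiv_add h3 h1]
    exact ⟨h3.add h1, congrArg _ h2⟩

variable [RiemannianBundle (fun x : M ↦ TangentSpace (𝓡 n) x)]
  [IsContMDiffRiemannianBundle (𝓡 n) ∞ (EuclideanSpace ℝ (Fin n))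
      (fun x : M ↦ TangentSpace (𝓡 n) x)] [T2Space M] [SecondCountableTopology M]

/-- For a `C¹` tensor `S`, `v (S(X, Z)) - S(∇_v X, Z)` is a combination of its values on coordinate
fields, with coefficients the components of `X` at the point. -/
theorem IsC1.mvfderiv_sub_eq_sum {S : TwoTensor n M} (hS : IsC1 S) {X Z : VField n M}
    {U V : Set M} {x : M} (hU : U ∈ 𝓝 x) (hV : V ∈ 𝓝 x) (hX : SmoothOn X U) (hZ : SmoothOn Z V)
    (v : TangentSpace (𝓡 n) x) :
    mvfderiv (𝓡 n) (fun y ↦ S y (X y) (Z y)) x v - S x (leviCivita X v) (Z x)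
      = ∑ j : Fin n, (chartDeriv x x (X x)) j *
        (mvfderiv (𝓡 n) (fun y ↦ S y
          (fieldOfCoord x (fun _ ↦ EuclideanSpace.single j (1 : ℝ)) y) (Z y)) x v
        - S x (leviCivita (fieldOfCoord x (fun _ ↦ EuclideanSpace.single j (1 : ℝ))) v) (Z x)) := by
  set ψ := chartAt (EuclideanSpace ℝ (Fin n)) x with hψ
  have hx : x ∈ ψ.source := mem_chart_source _ x
  have hψx : ψ.source ∈ 𝓝 x := ψ.open_source.mem_nhds hx
  let E : Fin n → VField n M := fun j ↦ fieldOfCoord x fun _ ↦ EuclideanSpace.single j (1 : ℝ)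
  let f : Fin n → M → ℝ := fun j y ↦ coordRep x X (ψ y) j
  let Y : Fin n → VField n M := fun j ↦ f j • E j
  have hE : ∀ j, SmoothOn (E j) ψ.source := fun j y hy ↦
    (contMDiffAt_fieldOfCoord hy contDiffAt_const).contMDiffWithinAt
  have hf : ∀ j, MDifferentiableAt (𝓡 n) 𝓘(ℝ) (f j) x := fun j ↦ by
    have h1 := contDiffAt_coordRep_chart hx (hX.contMDiffAt hU)
    have h2 : ContDiffAt ℝ ∞ (fun y ↦ (EuclideanSpace.proj j : EuclideanSpace ℝ (Fin n) →L[ℝ] ℝ)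
      (coordRep x X y)) (ψ x) :=
      (EuclideanSpace.proj j : EuclideanSpace ℝ (Fin n) →L[ℝ] ℝ).contDiff.contDiffAt.comp _ h1
    exact (contMDiffAt_comp_chart hx h2).mdifferentiableAt (by simp)
  have hSE : ∀ j, MDifferentiableAt (𝓡 n) 𝓘(ℝ) (fun y ↦ S y (E j y) (Z y)) x := fun j ↦
    hS.mdifferentiableAt hψx hV (hE j) hZ
  have hfx : ∀ j, f j x = (chartDeriv x x (X x)) j := fun j ↦ by
    simp only [f, hψ, coordRep_chart hx]
  have hXE : X =ᶠ[𝓝 x] (∑ j, Y j : VField n M) := by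
    filter_upwards [hψx] with y hy
    rw [Finset.sum_apply]
    exact eq_sum_coordRep_smul hy X
  have hSX : (fun y ↦ S y (X y) (Z y)) =ᶠ[𝓝 x] ∑ j, f j * fun y ↦ S y (E j y) (Z y) := by
    filter_upwards [hXE] with y hy
    rw [hy, Finset.sum_apply, Finset.sum_apply, map_sum, sum_apply]
    refine Finset.sum_congr rfl fun j _ ↦ ?_
    change S y (f j y • E j y) (Z y) = _
    rw [map_smul]
    rfl
  rw [mvfderiv_congr hSX, leviCivita_congr hXE,
    (mvfderiv_finset_sum _ _ (fun j _ ↦ (hf j).mul (hSE j)) v).2,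
    (leviCivita_sum _ Y (fun j _ ↦ DiffAt.smul (hf j) ((hE j).diffAt hψx)) v).2, map_sum,
    sum_apply, ← Finset.sum_sub_distrib]
  -- For each `j` the derivative of the coefficient occurs once in each of the two terms and
  -- cancels: this is tensoriality in `X`.
  refine Finset.sum_congr rfl fun j _ ↦ ?_
  change _ - S x (leviCivita (f j • E j) v) (Z x) = _
  rw [mvfderiv_mul (hf j) (hSE j), leviCivita_smul (hf j) ((hE j).diffAt hψx), map_add, map_smul,
    map_smul, ← hfx]
  change f j x * mvfderiv (𝓡 n) (fun y ↦ S y (E j y) (Z y)) x v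
      + S x (E j x) (Z x) * mvfderiv (𝓡 n) (f j) x v
    - (mvfderiv (𝓡 n) (f j) x v * S x (E j x) (Z x) + f j x * S x (leviCivita (E j) v) (Z x))
    = f j x * (mvfderiv (𝓡 n) (fun y ↦ S y (E j y) (Z y)) x v - S x (leviCivita (E j) v) (Z x))
  ring

/-- By the product rule the two sides differ by the contraction of `S` with `∇K`, which is zero for
a Killing field. -/
theorem IsC1.codiff_contract {S : TwoTensor n M} (hC : IsC1 S) (hS : IsSymm S) {K : VField n M}
    {U : Set M} (hK : IsKillingOn K U) {x : M} (hx : x ∈ U) :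
    codiff (contract S K) x = divAdjoint S (K x) := by
  have h0 := pairing_eq_zero_of_isKillingOn hS hK hx
  have hU := hK.isOpen.mem_nhds hx
  have h1 : ∀ i, covOneForm (contract S K) (onb x i) (onb x i)
      = covTwoTensor S (onb x i) (onb x i) (K x) + S x (onb x i) (leviCivita K (onb x i)) := by
    intro i
    obtain ⟨V, hV, hVs⟩ := exists_smoothOn_ext (onb x i)
    obtain ⟨W, hW, hWs⟩ := exists_smoothOn_ext (K x)
    -- `K` and the extension of `K x` agree at `x`, so by tensoriality either may be used to compute
    -- the covariant derivative of `S`.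
    have e1 := hC.mvfderiv_sub_eq_sum hU hV hK.smooth hVs (onb x i)
    have e2 := hC.mvfderiv_sub_eq_sum hW hV hWs hVs (onb x i)
    rw [ext_self (K x), ← e1, ext_self (onb x i)] at e2
    have e3 : (fun y ↦ S y (ext (onb x i) y) (ext (K x) y))
      = fun y ↦ S y (ext (K x) y) (ext (onb x i) y) := funext fun y ↦ hS y _ _
    simp only [covOneForm, covTwoTensor, contract]
    rw [e3, hS x (onb x i) (leviCivita K _), hS x (onb x i) (leviCivita (ext (K x)) _),
      hS x (leviCivita (ext (onb x i)) _) (K x)]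
    linarith
  rw [codiff, divAdjoint, Finset.sum_congr rfl fun i _ ↦ h1 i, Finset.sum_add_distrib]
  change - (_ + pairing S K x) = _
  rw [h0, add_zero]

end Classical

end RiemannianTensor

end

theorem mainTheorem2 {n : ℕ} {M : Type*} [TopologicalSpace M] [T2Space M]
    [SecondCountableTopology M] [ChartedSpace (EuclideanSpace ℝ (Fin n)) M]
    [IsManifold (𝓡 n) ∞ M] [Bundle.RiemannianBundle (fun x : M ↦ TangentSpace (𝓡 n) x)]
    [IsContMDiffRiemannianBundle (𝓡 n) ∞ (EuclideanSpace ℝ (Fin n))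
      (fun x : M ↦ TangentSpace (𝓡 n) x)]
    [MeasurableSpace M] [BorelSpace M]
    (hM : RiemannianTensor.IsSymmetricSpace n M)
    (S : RiemannianTensor.TwoTensor n M) (hS : RiemannianTensor.IsSymm S) :
    (RiemannianTensor.IsL1Loc S →
      (RiemannianTensor.WeakDivFree S ↔
        ∀ (U : Set M) (K : RiemannianTensor.VField n M), RiemannianTensor.IsKillingOn K U →
          RiemannianTensor.WeakCoclosedOn (RiemannianTensor.contract S K) U)) ∧
    (RiemannianTensor.IsC1 S →
      ((∀ (x : M) (w : TangentSpace (𝓡 n) x), RiemannianTensor.divAdjoint S w = 0) ↔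
        ∀ (U : Set M) (K : RiemannianTensor.VField n M), RiemannianTensor.IsKillingOn K U →
          ∀ x ∈ U, RiemannianTensor.codiff (RiemannianTensor.contract S K) x = 0)) := by
  refine ⟨fun hL ↦ ⟨fun h U K hK ↦ h.weakCoclosedOn hS hK, hM.weakDivFree hS hL⟩, fun hC ↦
    ⟨fun h U K hK x hx ↦ ?_, fun h x w ↦ ?_⟩⟩
  · rw [hC.codiff_contract hS hK hx, h]
  · obtain ⟨U, K, hx, hK, rfl⟩ := hM.exists_isKillingOn x w
    rw [← hC.codiff_contract hS hK hx, h U K hK x hx]
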